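/- Let $\Gamma$ be a countably infinite connected graph (loops are allowed) with symmetric weights $\mu_{x,y}=\mu_{y,x}>0$ on the edges $x\sim y$ (and $\mu_{x,y}=0$ otherwise), such that $\mu(x)=\sum_{y\sim x}\mu_{x,y}<\infty$ for every vertex $x$; put $\mu(A)=\sum_{y\in A}\mu(y)$ for $A\subset\Gamma$. Let $d$ be the graph distance, $B(x,R)=\{y: d(x,y)<R\}$ for real $R>0$, $V(x,R)=\mu(B(x,R))$ and $v(x,r,R)=V(x,R)-V(x,r)$. Let $(X_n)$ be the random walk with transition probabilities $P(x,y)=\mu_{x,y}/\mu(x)$, and let $Pf(x)=\sum_y P(x,y)f(y)$ and $\Delta=P-I$. Let $T_A=\min\{k\ge 0: X_k\notin A\}$ and $E(x,R)=\mathbb E(T_{B(x,R)}\mid X_0=x)$. For disjoint sets $A,B\subset\Gamma$ let $$\rho(A,B)=\Big(\inf\{(-\Delta f,f)_\mu : f \text{ finitely supported},\ f|_A=1,\ f|_B=0\}\Big)^{-1},\qquad (f,g)_\mu=\sum_x f(x)g(x)\mu(x),$$ and $\rho(x,r,R)=\rho(B(x,r),\Gamma\setminus B(x,R))$ for $R>r>0$.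 Suppose that the following conditions hold. - $(p_0)$: there is $p_0>0$ such that $\mu_{x,y}/\mu(x)\ge p_0$ for all $x\sim y$. - $(VD)$: there is $D_V>0$ such that $V(x,2R)\le D_V V(x,R)$ for all $x\in\Gamma$ and all real $R>0$. - $(H)$: there is $H>1$ such that for all $x\in\Gamma$, all real $R>0$ and every function $u\ge 0$, defined on $B(x,2R)$ and the neighbours of its points, with $Pu=u$ on $B(x,2R)$, one has $\max_{B(x,R)}u\le H\min_{B(x,R)}u$. - $(wTC)$: there is $C>0$ such that $E(x,R)\le C\,E(y,R)$ for all $x\in\Gamma$, all real $R>0$ and all $y\in B(x,R)$. Then there is a constant $C>1$ such that for all $x\in\Gamma$ and all real $R>\tfrac12$ $$C^{-1}\rho(x,R,2R)\,v(x,R,2R)\le E(x,2R)\le C\,\rho(x,R,2R)\,v(x,R,2R).$$ (For $0<R\le\tfrac12$ the annulus $B(x,2R)\setminus B(x,R)$ is empty and $v(x,R,2R)=0$.) -/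

import Mathlib

open MeasureTheory ProbabilityTheory
open scoped ENNReal

/-- A connected weighted graph on the vertex set `V`: symmetric nonnegative weights `μ_{x,y}`,
positive exactly on the edges `x ∼ y` (loops are allowed), with finite total weight at each vertex.
The graph is connected; loops play no role for connectedness and for the graph distance. -/
structure WeightedGraph (V : Type*) where
  weight : V → V → ℝ
  weight_symm : ∀ x y, weight x y = weight y x
  weight_nonneg : ∀ x y, 0 ≤ weight x y
  weight_summable : ∀ x, Summable (weight x)
  connected : (SimpleGraph.fromRel fun x y => 0 < weight x y).Connected

namespace WeightedGraph

noncomputable section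

variable {V : Type*} (Γ : WeightedGraph V)

/-- The underlying simple graph: `x` and `y` are adjacent iff `x ≠ y` and `0 < μ_{x,y}`. -/
def graph : SimpleGraph V := SimpleGraph.fromRel fun x y => 0 < Γ.weight x y

/-- The measure of a vertex, `μ(x) = ∑_y μ_{x,y}`. -/
def mass (x : V) : ℝ := ∑' y, Γ.weight x y

/-- The transition probabilities `P(x,y) = μ_{x,y} / μ(x)`. -/
def trans (x y : V) : ℝ := Γ.weight x y / Γ.mass x

/-- The open ball `B(x,R)` for the graph distance. -/
def ball (x : V) (R : ℝ) : Set V := {y | (Γ.graph.dist x y : ℝ) < R}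

/-- The volume `V(x,R) = μ(B(x,R))`. -/
def vol (x : V) (R : ℝ) : ℝ := ∑' y : Γ.ball x R, Γ.mass y

/-- The volume of the annulus, `v(x,r,R) = V(x,R) - V(x,r)`. -/
def annulusVol (x : V) (r R : ℝ) : ℝ := Γ.vol x R - Γ.vol x r

/-! ### The Laplace operator and the resistance -/

/-- The Markov operator `P f(x) = ∑_y P(x,y) f(y)`. -/
def markovOp (f : V → ℝ) (x : V) : ℝ := ∑' y, Γ.trans x y * f y

/-- The Laplace operator `Δ = P - I`. -/
def laplacian (f : V → ℝ) (x : V) : ℝ := Γ.markovOp f x - f x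

/-- The inner product `(f,g)_μ = ∑_x f(x) g(x) μ(x)`. -/
def innerMu (f g : V → ℝ) : ℝ := ∑' x, f x * g x * Γ.mass x

/-- The resistance between two sets: the inverse of the infimum of the energy `(-Δ f, f)_μ` over
the finitely supported `f` with `f = 1` on `A` and `f = 0` on `B`. -/
def resistance (A B : Set V) : ℝ :=
  (sInf {q : ℝ | ∃ f : V → ℝ, f.support.Finite ∧ (∀ x ∈ A, f x = 1) ∧ (∀ x ∈ B, f x = 0) ∧
    q = Γ.innerMu (-Γ.laplacian f) f})⁻¹

/-- The resistance of the annulus, `ρ(x,r,R) = ρ(B(x,r), Γ \ B(x,R))`. -/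
def annulusRes (x : V) (r R : ℝ) : ℝ := Γ.resistance (Γ.ball x r) (Γ.ball x R)ᶜ

/-! ### The random walk and the mean exit time -/

theorem mass_pos [Nontrivial V] (x : V) : 0 < Γ.mass x := by
  obtain ⟨y, hy⟩ := Γ.connected.preconnected.exists_adj_of_nontrivial x
  have h : 0 < Γ.weight x y := by
    rw [SimpleGraph.fromRel_adj] at hy
    rcases hy.2 with h | h
    · exact h
    · rwa [Γ.weight_symm]
  exact (Γ.weight_summable x).tsum_pos (Γ.weight_nonneg x) y h

theorem tsum_ofReal_trans [Nontrivial V] (x : V) :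
    ∑' y, ENNReal.ofReal (Γ.trans x y) = 1 := by
  have hx := Γ.mass_pos x
  simp only [trans]
  rw [← ENNReal.ofReal_tsum_of_nonneg
    (fun y => div_nonneg (Γ.weight_nonneg x y) hx.le) ((Γ.weight_summable x).div_const _)]
  rw [tsum_div_const, show ∑' y, Γ.weight x y = Γ.mass x from rfl, div_self hx.ne',
    ENNReal.ofReal_one]

/-- The law `P(x,·)` of one step of the walk from `x`. -/
def stepPMF [Nontrivial V] (x : V) : PMF V :=
  ⟨fun y => ENNReal.ofReal (Γ.trans x y),
    Γ.tsum_ofReal_trans x ▸ ENNReal.summable.hasSum⟩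

variable [Nontrivial V] [MeasurableSpace V] [DiscreteMeasurableSpace V]

/-- One step of the walk, as a kernel. -/
def stepKernel : Kernel V V := ⟨fun x => (Γ.stepPMF x).toMeasure, .of_discrete⟩

instance : IsMarkovKernel Γ.stepKernel :=
  ⟨fun x => inferInstanceAs (IsProbabilityMeasure (Γ.stepPMF x).toMeasure)⟩

/-- Given `(X_0, …, X_n)`, the next position `X_{n+1}` has law `P(X_n, ·)`. -/
def historyKernel (n : ℕ) : Kernel ((_ : Finset.Iic n) → V) V :=
  Γ.stepKernel.comap (fun h => h ⟨n, Finset.mem_Iic.2 le_rfl⟩) (measurable_pi_apply _)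

instance (n : ℕ) : IsMarkovKernel (Γ.historyKernel n) :=
  inferInstanceAs (IsMarkovKernel (Γ.stepKernel.comap _ _))

/-- The law of the random walk `(X_n)_{n ≥ 0}` with `X_0 = z`, a measure on the space of
trajectories `ℕ → V`. -/
def walkLaw (z : V) : Measure (ℕ → V) :=
  Kernel.traj (X := fun _ => V) Γ.historyKernel 0 (fun _ => z)

/-- The exit time `T_A = min {k : X_k ∉ A}` of a trajectory (`∞` if it never leaves `A`). -/
def exitTime (A : Set V) (ω : ℕ → V) : ℝ≥0∞ := ⨅ (k : ℕ) (_ : ω k ∉ A), (k : ℝ≥0∞)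

/-- The mean exit time `E_z(A) = 𝔼(T_A | X_0 = z)`. -/
def meanExitFrom (z : V) (A : Set V) : ℝ≥0∞ := ∫⁻ ω, exitTime A ω ∂Γ.walkLaw z

/-- The mean exit time `E(x,R) = E_x(B(x,R))`. -/
def meanExit (x : V) (R : ℝ) : ℝ≥0∞ := Γ.meanExitFrom x (Γ.ball x R)

/-- Weak time comparison: `E(x,R) ≤ C E(y,R)` for all `R > 0` and `y ∈ B(x,R)`. -/
def WeakTimeComparison : Prop :=
  ∃ C : ℝ, 0 < C ∧ ∀ (x : V) (R : ℝ), 0 < R → ∀ y ∈ Γ.ball x R,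
    Γ.meanExit x R ≤ ENNReal.ofReal C * Γ.meanExit y R

end

/-! ### Conditions on the weighted graph -/

variable {V : Type*} (Γ : WeightedGraph V)

/-- Controlled weights: `P(x,y) ≥ p₀ > 0` for all edges `x ∼ y`. -/
def ControlledWeights : Prop :=
  ∃ p₀ : ℝ, 0 < p₀ ∧ ∀ x y : V, 0 < Γ.weight x y → p₀ ≤ Γ.weight x y / Γ.mass x

/-- Volume doubling. -/
def VolumeDoubling : Prop :=
  ∃ D : ℝ, 0 < D ∧ ∀ (x : V) (R : ℝ), 0 < R → Γ.vol x (2 * R) ≤ D * Γ.vol x R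

/-- `A` together with all neighbours of its points. -/
def closedNbhd (A : Set V) : Set V := A ∪ {y | ∃ x ∈ A, 0 < Γ.weight x y}

/-- `u` is harmonic on `A`; only the values of `u` on `closedNbhd A` matter. -/
def HarmonicOn (u : V → ℝ) (A : Set V) : Prop := ∀ x ∈ A, Γ.markovOp u x = u x

/-- The elliptic Harnack inequality. -/
def EllipticHarnack : Prop :=
  ∃ H : ℝ, 1 < H ∧ ∀ (x : V) (R : ℝ), 0 < R → ∀ u : V → ℝ,
    (∀ y ∈ Γ.closedNbhd (Γ.ball x (2 * R)), 0 ≤ u y) → Γ.HarmonicOn u (Γ.ball x (2 * R)) →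
      ∀ y ∈ Γ.ball x R, ∀ z ∈ Γ.ball x R, u y ≤ H * u z

end WeightedGraph

/-!
Let `g` be the Green kernel, with pole `x`, of the walk killed on leaving `B(x,2R)`, normalized to
be symmetric, so that `E(x,2R) = ∑_z g(z) μ(z)`. Harnack's inequality along geodesics, together with
the symmetry of the kernel, shows that `g` is constant up to a factor on each sphere around `x`.
Hence, by the maximum principle, the superlevel sets of `g` are comparable to balls. Truncating `g`
near its value on the outermost sphere of `B(x,R)` gives, up to a factor, an optimal function for
the resistance, so `ρ(x,R,2R)` is comparable to this value.

Summing `g` over `B(x,R)` and doubling the volume, we get the lower bound for `E(x,2R)`. For the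
upper bound, `g` is at most a multiple of `ρ(x,R,2R)` off `B(x,R-1)`, so that
`E(x,2R) - E(x,R-1)` is at most a multiple of `ρ(x,R,2R) V(x,2R)`. Conversely, the walk leaves
`B(x,R-1)` at a point `y ∈ B(x,R)`, and by (wTC) it then needs at least a multiple of `E(x,R)` to
leave `B(y,R) ⊆ B(x,2R)`. So the same difference also controls `E(x,R-1)`, hence `E(x,2R)`.
-/

namespace WeightedGraph

variable {V : Type*} {Γ : WeightedGraph V}

/-- Every vertex has only finitely many neighbours, so that the Markov operator is defined by
finite sums. It is a class because every statement on the Markov operator depends on it. -/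
class FiniteDegree (Γ : WeightedGraph V) : Prop where
  finite_support_weight : ∀ x, (Function.support (Γ.weight x)).Finite

theorem weight_pos_of_ne_zero {x y : V} (h : Γ.weight x y ≠ 0) : 0 < Γ.weight x y :=
  lt_of_le_of_ne (Γ.weight_nonneg x y) h.symm

-- The transition probabilities from a vertex are summable, so only finitely many exceed `p₀`.
theorem ControlledWeights.finiteDegree (hp : Γ.ControlledWeights) : Γ.FiniteDegree := by
  obtain ⟨p₀, hp₀, hp⟩ := hp
  refine ⟨fun x => ?_⟩
  have hs : Summable fun y => Γ.weight x y / Γ.mass x := (Γ.weight_summable x).div_const _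
  have h : ∀ᶠ y in Filter.cofinite, Γ.weight x y / Γ.mass x < p₀ :=
    hs.tendsto_cofinite_zero.eventually (gt_mem_nhds hp₀)
  refine Set.Finite.subset h fun y hy => ?_
  simpa using hp x y (weight_pos_of_ne_zero hy)

/-! ### The graph distance -/

theorem graph_adj {x y : V} : Γ.graph.Adj x y ↔ x ≠ y ∧ 0 < Γ.weight x y := by
  simp [graph, SimpleGraph.fromRel_adj, Γ.weight_symm y x]

theorem graph_connected (Γ : WeightedGraph V) : Γ.graph.Connected := Γ.connected

theorem dist_le_succ_of_weight_pos (x : V) {y z : V} (h : 0 < Γ.weight y z) :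
    Γ.graph.dist x z ≤ Γ.graph.dist x y + 1 := by
  rcases eq_or_ne y z with rfl | hyz
  · exact Nat.le_succ _
  · have hadj : Γ.graph.Adj y z := graph_adj.2 ⟨hyz, h⟩
    simpa only [SimpleGraph.dist_eq_one_iff_adj.2 hadj] using
      Γ.graph_connected.dist_triangle (u := x) (v := y) (w := z)

theorem exists_geodesic (Γ : WeightedGraph V) (x y : V) :
    ∃ p : ℕ → V, p 0 = x ∧ p (Γ.graph.dist x y) = y ∧
      ∀ i j, i ≤ j → j ≤ Γ.graph.dist x y → Γ.graph.dist (p i) (p j) = j - i := by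
  obtain ⟨w, hw⟩ := Γ.graph_connected.exists_walk_length_eq_dist x y
  refine ⟨w.getVert, w.getVert_zero, by rw [← hw, w.getVert_length], fun i j hij hj => ?_⟩
  have hsub : ((w.take j).drop i).IsSubwalk w :=
    ((w.take j).isSubwalk_drop i).trans (w.isSubwalk_take j)
  have hlen := SimpleGraph.length_eq_dist_of_subwalk hw hsub
  simp only [SimpleGraph.Walk.drop_length, SimpleGraph.Walk.take_length,
    SimpleGraph.Walk.take_getVert, min_eq_right hij, hw, min_eq_left hj] at hlen
  exact hlen.symm

theorem exists_weight_pos_of_dist_eq_succ {x y : V} {n : ℕ} (h : Γ.graph.dist x y = n + 1) :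
    ∃ z, Γ.graph.dist x z = n ∧ 0 < Γ.weight z y := by
  obtain ⟨p, hp₀, hpy, hp⟩ := exists_geodesic Γ x y
  rw [h] at hpy hp
  have hlast : Γ.graph.dist (p n) (p (n + 1)) = 1 := by rw [hp n (n + 1) (by omega) le_rfl]; omega
  refine ⟨p n, by simpa only [hp₀, Nat.sub_zero] using hp 0 n (by omega) (by omega), ?_⟩
  rw [hpy] at hlast
  exact (graph_adj.1 (SimpleGraph.dist_eq_one_iff_adj.1 hlast)).2

theorem finite_dist_le [Γ.FiniteDegree] (x : V) (n : ℕ) : {y | Γ.graph.dist x y ≤ n}.Finite := by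
  induction n with
  | zero =>
    refine (Set.finite_singleton x).subset fun y hy => ?_
    exact (Γ.graph_connected.dist_eq_zero_iff.1 (Nat.le_zero.1 hy)).symm
  | succ n ih =>
    refine (ih.union (ih.biUnion fun y _ => FiniteDegree.finite_support_weight (Γ := Γ) y)).subset
      fun z hz => ?_
    rcases Nat.le_succ_iff.1 hz with hz | hz
    · exact .inl hz
    · obtain ⟨y, hy, hyz⟩ := exists_weight_pos_of_dist_eq_succ hz
      exact .inr (Set.mem_biUnion hy.le hyz.ne')

theorem mem_ball {x y : V} {R : ℝ} : y ∈ Γ.ball x R ↔ (Γ.graph.dist x y : ℝ) < R := Iff.rfl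

theorem self_mem_ball (x : V) {R : ℝ} (hR : 0 < R) : x ∈ Γ.ball x R := by
  simpa [mem_ball] using hR

theorem finite_ball [Γ.FiniteDegree] (x : V) (R : ℝ) : (Γ.ball x R).Finite :=
  (finite_dist_le x ⌈R⌉₊).subset fun _ hy => (Nat.lt_ceil.2 hy).le

theorem exists_dist_eq [Infinite V] [Γ.FiniteDegree] (x : V) (n : ℕ) :
    ∃ y, Γ.graph.dist x y = n := by
  obtain ⟨z, hz⟩ : ∃ z, n ≤ Γ.graph.dist x z := by
    obtain ⟨z, hz⟩ := (finite_dist_le (Γ := Γ) x n).infinite_compl.nonempty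
    exact ⟨z, (not_le.1 fun h => hz h).le⟩
  obtain ⟨p, hp₀, -, hp⟩ := exists_geodesic Γ x z
  exact ⟨p n, by simpa [hp₀] using hp 0 n (Nat.zero_le _) hz⟩

/-! ### The Markov operator and the minimum principle -/

theorem trans_nonneg (x y : V) : 0 ≤ Γ.trans x y :=
  div_nonneg (Γ.weight_nonneg x y) (tsum_nonneg (Γ.weight_nonneg x))

theorem summable_trans_mul [Γ.FiniteDegree] (f : V → ℝ) (x : V) :
    Summable fun y => Γ.trans x y * f y :=
  summable_of_hasFiniteSupport <| (FiniteDegree.finite_support_weight (Γ := Γ) x).subset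
    fun y hy h => hy (by simp [trans, h])

/-- The Markov operator as a linear map on all functions, which needs finite degrees. -/
noncomputable def markovLinearMap (Γ : WeightedGraph V) [Γ.FiniteDegree] :
    (V → ℝ) →ₗ[ℝ] (V → ℝ) where
  toFun := Γ.markovOp
  map_add' f g := by
    ext x
    simp only [markovOp, Pi.add_apply, mul_add]
    exact (summable_trans_mul f x).tsum_add (summable_trans_mul g x)
  map_smul' c f := by
    ext x
    simp only [markovOp, Pi.smul_apply, smul_eq_mul, RingHom.id_apply, mul_left_comm _ c,
      tsum_mul_left]

theorem markovOp_sub [Γ.FiniteDegree] (f g : V → ℝ) :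
    Γ.markovOp (f - g) = Γ.markovOp f - Γ.markovOp g := map_sub Γ.markovLinearMap f g

theorem markovOp_neg [Γ.FiniteDegree] (f : V → ℝ) : Γ.markovOp (-f) = -Γ.markovOp f :=
  map_neg Γ.markovLinearMap f

theorem markovOp_const [Nontrivial V] (c : ℝ) (x : V) : Γ.markovOp (fun _ => c) x = c := by
  simp only [markovOp, trans, tsum_mul_right, tsum_div_const]
  rw [← mass, div_self (Γ.mass_pos x).ne', one_mul]

theorem markovOp_mono [Γ.FiniteDegree] {f g : V → ℝ} {x : V}
    (hfg : ∀ y, 0 < Γ.weight x y → f y ≤ g y) : Γ.markovOp f x ≤ Γ.markovOp g x := by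
  refine (summable_trans_mul f x).tsum_le_tsum (fun y => ?_) (summable_trans_mul g x)
  by_cases hy : Γ.weight x y = 0
  · simp [trans, hy]
  · exact mul_le_mul_of_nonneg_left (hfg y (weight_pos_of_ne_zero hy)) (trans_nonneg x y)

theorem trans_mul_le_markovOp [Γ.FiniteDegree] {f : V → ℝ} {x : V}
    (hf : ∀ y, 0 < Γ.weight x y → 0 ≤ f y) (y : V) : Γ.trans x y * f y ≤ Γ.markovOp f x := by
  refine (summable_trans_mul f x).le_tsum y fun z _ => ?_
  by_cases hz : Γ.weight x z = 0
  · simp [trans, hz]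
  · exact mul_nonneg (trans_nonneg x z) (hf z (weight_pos_of_ne_zero hz))

theorem trans_pos [Nontrivial V] {x y : V} (h : 0 < Γ.weight x y) : 0 < Γ.trans x y :=
  div_pos h (Γ.mass_pos x)

/-- `u` is superharmonic on `A`: the inequality `P u ≤ u` holds there. As for `HarmonicOn`, only the
values of `u` on `closedNbhd A` matter. -/
def SuperharmonicOn (Γ : WeightedGraph V) (u : V → ℝ) (A : Set V) : Prop :=
  ∀ x ∈ A, Γ.markovOp u x ≤ u x

theorem HarmonicOn.superharmonicOn {u : V → ℝ} {A : Set V} (hu : Γ.HarmonicOn u A) :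
    Γ.SuperharmonicOn u A := fun x hx => (hu x hx).le

theorem HarmonicOn.neg [Γ.FiniteDegree] {u : V → ℝ} {A : Set V} (hu : Γ.HarmonicOn u A) :
    Γ.HarmonicOn (-u) A := fun x hx => by
  rw [markovOp_neg, Pi.neg_apply, Pi.neg_apply, hu x hx]

theorem HarmonicOn.mono {u : V → ℝ} {A B : Set V} (hu : Γ.HarmonicOn u B) (hAB : A ⊆ B) :
    Γ.HarmonicOn u A := fun x hx => hu x (hAB hx)

theorem SuperharmonicOn.inf_const [Nontrivial V] [Γ.FiniteDegree] {u : V → ℝ} {A : Set V}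
    (hu : Γ.SuperharmonicOn u A) (c : ℝ) : Γ.SuperharmonicOn (fun z => min (u z) c) A :=
  fun x hx => le_min ((markovOp_mono fun _ _ => min_le_left _ _).trans (hu x hx))
    ((markovOp_mono fun _ _ => min_le_right _ _).trans_eq (markovOp_const c x))

theorem SuperharmonicOn.eq_of_forall_le [Nontrivial V] [Γ.FiniteDegree] {A : Set V} {u : V → ℝ}
    (hu : Γ.SuperharmonicOn u A) {x y : V} (hx : x ∈ A) (hxy : 0 < Γ.weight x y)
    (hmin : ∀ z, 0 < Γ.weight x z → u x ≤ u z) : u y = u x := by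
  refine le_antisymm ?_ (hmin y hxy)
  have h := trans_mul_le_markovOp (f := u - fun _ => u x)
    (fun z hz => sub_nonneg.2 (hmin z hz)) y
  simp only [markovOp_sub, Pi.sub_apply, markovOp_const] at h
  exact sub_nonpos.1 (nonpos_of_mul_nonpos_right (h.trans (sub_nonpos.2 (hu x hx)))
    (trans_pos hxy))

theorem SuperharmonicOn.le_of_boundary [Infinite V] [Γ.FiniteDegree] {U : Finset V} {u : V → ℝ}
    (hu : Γ.SuperharmonicOn u U) {c : ℝ} (hc : ∀ z ∈ Γ.closedNbhd U \ U, c ≤ u z) {z : V}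
    (hz : z ∈ U) : c ≤ u z := by
  obtain ⟨x₀, hx₀U, hx₀⟩ := U.exists_min_image u ⟨z, hz⟩
  refine le_trans ?_ (hx₀ z hz)
  by_contra! hlt
  have hmin : ∀ y ∈ Γ.closedNbhd U, u x₀ ≤ u y := fun y hy => by
    by_cases hyU : y ∈ U
    · exact hx₀ y hyU
    · exact hlt.le.trans (hc y ⟨hy, hyU⟩)
  have hstep : ∀ x ∈ {x | x ∈ U ∧ u x = u x₀}, ∀ y, Γ.graph.Adj x y →
      y ∈ {x | x ∈ U ∧ u x = u x₀} := by
    rintro x ⟨hxU, hx⟩ y hxy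
    have hw := (graph_adj.1 hxy).2
    have hy : u y = u x₀ := hx ▸ hu.eq_of_forall_le hxU hw
      fun v hv => hx ▸ hmin v (.inr ⟨x, hxU, hv⟩)
    refine ⟨by_contra fun hyU => ?_, hy⟩
    exact hlt.not_ge (hy ▸ hc y ⟨.inr ⟨x, hxU, hw⟩, hyU⟩)
  have hwalk : ∀ {x y : V}, Γ.graph.Walk x y → x ∈ {x | x ∈ U ∧ u x = u x₀} →
      y ∈ {x | x ∈ U ∧ u x = u x₀} := fun w => by
    induction w with
    | nil => exact id
    | cons hadj _ ih => exact fun hx => ih (hstep _ hx _ hadj)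
  obtain ⟨y, hy⟩ := Infinite.exists_notMem_finset U
  obtain ⟨w⟩ := Γ.graph_connected.preconnected x₀ y
  exact hy (hwalk w ⟨hx₀U, rfl⟩).1

theorem SuperharmonicOn.le_of_compl [Infinite V] [Γ.FiniteDegree] {U : Finset V} {u : V → ℝ}
    (hu : Γ.SuperharmonicOn u U) {c : ℝ} (hc : ∀ z ∉ U, c ≤ u z) (z : V) : c ≤ u z := by
  by_cases hz : z ∈ U
  · exact hu.le_of_boundary (fun w hw => hc w hw.2) hz
  · exact hc z hz

theorem HarmonicOn.le_of_boundary [Infinite V] [Γ.FiniteDegree] {U : Finset V} {u : V → ℝ}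
    (hu : Γ.HarmonicOn u U) {c : ℝ} (hc : ∀ z ∈ Γ.closedNbhd U \ U, u z ≤ c) {z : V}
    (hz : z ∈ U) : u z ≤ c :=
  neg_le_neg_iff.1 (hu.neg.superharmonicOn.le_of_boundary (fun w hw => neg_le_neg (hc w hw)) hz)

theorem HarmonicOn.le_of_compl [Infinite V] [Γ.FiniteDegree] {U : Finset V} {u : V → ℝ}
    (hu : Γ.HarmonicOn u U) {c : ℝ} (hc : ∀ z ∉ U, u z ≤ c) (z : V) : u z ≤ c :=
  neg_le_neg_iff.1 (hu.neg.superharmonicOn.le_of_compl (fun w hw => neg_le_neg (hc w hw)) z)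

/-! ### The Poisson equation on a finite set -/

-- Uniqueness for the Dirichlet problem gives existence, because `U` is finite.
theorem poisson_surjective [Infinite V] [Γ.FiniteDegree] (U : Finset V) :
    Function.Surjective ((LinearMap.funLeft ℝ ℝ ((↑) : U → V)) ∘ₗ
      (LinearMap.id - Γ.markovLinearMap) ∘ₗ Function.ExtendByZero.linearMap ℝ ((↑) : U → V)) := by
  refine LinearMap.injective_iff_surjective.1 ((injective_iff_map_eq_zero _).2 fun φ hφ => ?_)
  set u : V → ℝ := Function.ExtendByZero.linearMap ℝ ((↑) : U → V) φ
  have hu_coe : ∀ z : U, u z = φ z := fun z => Subtype.val_injective.extend_apply φ 0 z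
  have hu_zero : ∀ z ∉ U, u z = 0 := fun z hz =>
    Function.extend_apply' φ (0 : V → ℝ) z fun ⟨w, hw⟩ => hz (hw ▸ w.2)
  have hharm : Γ.HarmonicOn u U := fun z hz => (sub_eq_zero.1 (congrFun hφ ⟨z, hz⟩)).symm
  ext z
  rw [← hu_coe z]
  exact le_antisymm (hharm.le_of_compl (fun w hw => (hu_zero w hw).le) z)
    (hharm.superharmonicOn.le_of_compl (fun w hw => (hu_zero w hw).ge) z)

theorem exists_poisson [Infinite V] [Γ.FiniteDegree] (U : Finset V) (f : V → ℝ) :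
    ∃ u : V → ℝ, (∀ z ∉ U, u z = 0) ∧ ∀ z ∈ U, u z - Γ.markovOp u z = f z := by
  obtain ⟨φ, hφ⟩ := poisson_surjective (Γ := Γ) U fun z => f z
  refine ⟨Function.ExtendByZero.linearMap ℝ ((↑) : U → V) φ, fun z hz => ?_, fun z hz => ?_⟩
  · exact Function.extend_apply' φ (0 : V → ℝ) z fun ⟨w, hw⟩ => hz (hw ▸ w.2)
  · exact congrFun hφ ⟨z, hz⟩

/-- The potential of the source `f` on the finite set `U`: the solution of the Poisson equation
`u - P u = f` on `U` that vanishes outside `U`. -/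
noncomputable def potential (Γ : WeightedGraph V) [Infinite V] [Γ.FiniteDegree] (U : Finset V)
    (f : V → ℝ) : V → ℝ := (exists_poisson (Γ := Γ) U f).choose

section Potential

variable [Infinite V] [Γ.FiniteDegree] {U W : Finset V} {f : V → ℝ}

theorem potential_eq_zero {z : V} (hz : z ∉ U) : Γ.potential U f z = 0 :=
  (exists_poisson U f).choose_spec.1 z hz

theorem potential_sub_markovOp {z : V} (hz : z ∈ U) :
    Γ.potential U f z - Γ.markovOp (Γ.potential U f) z = f z :=
  (exists_poisson U f).choose_spec.2 z hz

theorem superharmonicOn_potential (hf : ∀ z ∈ U, 0 ≤ f z) :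
    Γ.SuperharmonicOn (Γ.potential U f) U := fun z hz =>
  sub_nonneg.1 ((hf z hz).trans_eq (potential_sub_markovOp hz).symm)

theorem potential_nonneg (hf : ∀ z ∈ U, 0 ≤ f z) (z : V) : 0 ≤ Γ.potential U f z :=
  (superharmonicOn_potential hf).le_of_compl (fun _ hw => (potential_eq_zero hw).ge) z

theorem potential_one_nonneg (z : V) : 0 ≤ Γ.potential U 1 z :=
  potential_nonneg (fun _ _ => zero_le_one) z

theorem harmonicOn_potential_sub_potential (hWU : W ⊆ U) :
    Γ.HarmonicOn (Γ.potential U f - Γ.potential W f) W := fun z hz => by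
  have hU := potential_sub_markovOp (Γ := Γ) (f := f) (hWU hz)
  have hW := potential_sub_markovOp (Γ := Γ) (f := f) hz
  rw [markovOp_sub, Pi.sub_apply, Pi.sub_apply]
  linarith

theorem potential_mono (hWU : W ⊆ U) (hf : ∀ z ∈ U, 0 ≤ f z) (z : V) :
    Γ.potential W f z ≤ Γ.potential U f z :=
  sub_nonneg.1 <| (harmonicOn_potential_sub_potential hWU).superharmonicOn.le_of_compl
    (fun w hw => by simpa [potential_eq_zero hw] using potential_nonneg hf w) z

theorem potential_le_potential_add (hWU : W ⊆ U) {M : ℝ} (hM : ∀ z ∉ W, Γ.potential U f z ≤ M)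
    (z : V) : Γ.potential U f z ≤ Γ.potential W f z + M :=
  sub_le_iff_le_add'.1 <| (harmonicOn_potential_sub_potential hWU).le_of_compl
    (fun w hw => by simpa [potential_eq_zero hw] using hM w hw) z

theorem potential_add_le_potential (hWU : W ⊆ U) {c : ℝ}
    (hc : ∀ z ∈ Γ.closedNbhd W \ W, c ≤ Γ.potential U f z) {z : V} (hz : z ∈ W) :
    Γ.potential W f z + c ≤ Γ.potential U f z :=
  le_sub_iff_add_le'.1 <|
    (harmonicOn_potential_sub_potential hWU).superharmonicOn.le_of_boundary
      (fun w hw => by simpa [potential_eq_zero (mt Finset.mem_coe.2 hw.2)] using hc w hw) hz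

end Potential

/-! ### The energy form -/

/-- The bilinear form `(a, b) ↦ (-Δ a, b)_μ` on functions supported in `U`; it is defined on all
functions by restricting both sums to `U`. -/
noncomputable def energyForm (Γ : WeightedGraph V) (U : Finset V) :
    LinearMap.BilinForm ℝ (V → ℝ) :=
  LinearMap.mk₂ ℝ
    (fun a b => ∑ z ∈ U, (Γ.mass z * a z - ∑ w ∈ U, Γ.weight z w * a w) * b z)
    (fun a a' b => by
      rw [← Finset.sum_add_distrib]
      refine Finset.sum_congr rfl fun z _ => ?_
      simp only [Pi.add_apply, mul_add, Finset.sum_add_distrib]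
      ring)
    (fun c a b => by
      rw [smul_eq_mul, Finset.mul_sum]
      refine Finset.sum_congr rfl fun z _ => ?_
      simp only [Pi.smul_apply, smul_eq_mul, mul_left_comm _ c, ← Finset.mul_sum]
      ring)
    (fun a b b' => by simp only [Pi.add_apply, mul_add, Finset.sum_add_distrib])
    (fun c a b => by
      simp only [Pi.smul_apply, smul_eq_mul, mul_left_comm _ c, ← Finset.mul_sum])

theorem energyForm_apply (U : Finset V) (a b : V → ℝ) : Γ.energyForm U a b =
    ∑ z ∈ U, (Γ.mass z * a z - ∑ w ∈ U, Γ.weight z w * a w) * b z := rfl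

theorem energyForm_comm (U : Finset V) (a b : V → ℝ) :
    Γ.energyForm U a b = Γ.energyForm U b a := by
  simp only [energyForm_apply, sub_mul, Finset.sum_sub_distrib, Finset.sum_mul]
  congr 1
  · exact Finset.sum_congr rfl fun z _ => by ring
  · rw [Finset.sum_comm]
    refine Finset.sum_congr rfl fun z _ => Finset.sum_congr rfl fun w _ => ?_
    rw [Γ.weight_symm]
    ring

theorem sum_weight_le_mass (U : Finset V) (z : V) : ∑ w ∈ U, Γ.weight z w ≤ Γ.mass z :=
  (Γ.weight_summable z).sum_le_tsum U fun w _ => Γ.weight_nonneg z w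

theorem energyForm_self_nonneg (U : Finset V) (a : V → ℝ) : 0 ≤ Γ.energyForm U a a := by
  have hcross : ∑ z ∈ U, ∑ w ∈ U, Γ.weight z w * (2 * (a z * a w)) ≤
      ∑ z ∈ U, ∑ w ∈ U, (Γ.weight z w * a z ^ 2 + Γ.weight z w * a w ^ 2) :=
    Finset.sum_le_sum fun z _ => Finset.sum_le_sum fun w _ => by
      rw [← mul_add]
      exact mul_le_mul_of_nonneg_left (by linarith [two_mul_le_add_sq (a z) (a w)])
        (Γ.weight_nonneg z w)
  have hswap : ∑ z ∈ U, ∑ w ∈ U, Γ.weight z w * a w ^ 2 =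
      ∑ z ∈ U, ∑ w ∈ U, Γ.weight z w * a z ^ 2 := by
    rw [Finset.sum_comm]
    exact Finset.sum_congr rfl fun z _ => Finset.sum_congr rfl fun w _ => by rw [Γ.weight_symm]
  have hdiag : ∑ z ∈ U, ∑ w ∈ U, Γ.weight z w * a z ^ 2 ≤ ∑ z ∈ U, Γ.mass z * a z ^ 2 :=
    Finset.sum_le_sum fun z _ => by
      rw [← Finset.sum_mul]
      exact mul_le_mul_of_nonneg_right (sum_weight_le_mass U z) (sq_nonneg _)
  have hexpand : 2 * Γ.energyForm U a a = 2 * ∑ z ∈ U, Γ.mass z * a z ^ 2 -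
      ∑ z ∈ U, ∑ w ∈ U, Γ.weight z w * (2 * (a z * a w)) := by
    rw [energyForm_apply, Finset.mul_sum, Finset.mul_sum, ← Finset.sum_sub_distrib]
    refine Finset.sum_congr rfl fun z _ => ?_
    rw [sub_mul, mul_sub, Finset.sum_mul, Finset.mul_sum]
    congr 1
    · ring
    · exact Finset.sum_congr rfl fun w _ => by ring
  simp only [Finset.sum_add_distrib] at hcross
  linarith

theorem sq_energyForm_le (U : Finset V) (a b : V → ℝ) :
    Γ.energyForm U a b ^ 2 ≤ Γ.energyForm U a a * Γ.energyForm U b b :=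
  (Γ.energyForm U).apply_sq_le_of_symm (energyForm_self_nonneg U) ⟨energyForm_comm U⟩ a b

theorem energyForm_eq_sum [Nontrivial V] {U : Finset V} {a : V → ℝ} (ha : ∀ z ∉ U, a z = 0)
    (b : V → ℝ) :
    Γ.energyForm U a b = ∑ z ∈ U, (a z - Γ.markovOp a z) * b z * Γ.mass z := by
  refine Finset.sum_congr rfl fun z _ => ?_
  have hmass : Γ.mass z ≠ 0 := (Γ.mass_pos z).ne'
  have hP : Γ.markovOp a z = (∑ w ∈ U, Γ.weight z w * a w) / Γ.mass z := by
    rw [markovOp, tsum_eq_sum fun w hw => by rw [ha w hw, mul_zero], Finset.sum_div]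
    exact Finset.sum_congr rfl fun w _ => by rw [trans, div_mul_eq_mul_div]
  rw [hP]
  field_simp

theorem innerMu_neg_laplacian [Nontrivial V] {U : Finset V} {f : V → ℝ} (hf : ∀ z ∉ U, f z = 0) :
    Γ.innerMu (-Γ.laplacian f) f = Γ.energyForm U f f := by
  rw [innerMu, tsum_eq_sum fun z hz => by rw [hf z hz, mul_zero, zero_mul], energyForm_eq_sum hf]
  simp only [Pi.neg_apply, laplacian, neg_sub]

/-! ### The Green kernel -/

open Classical in
/-- The Green kernel `g^U(x, ·)` of the walk killed outside `U`, with pole `x`. It is normalized by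
`μ(x)⁻¹`, which makes it symmetric. -/
noncomputable def green (Γ : WeightedGraph V) [Infinite V] [Γ.FiniteDegree] (U : Finset V)
    (x : V) : V → ℝ := Γ.potential U (Pi.single x (Γ.mass x)⁻¹)

theorem green_source_nonneg [Nontrivial V] [DecidableEq V] (x z : V) :
    0 ≤ (Pi.single x (Γ.mass x)⁻¹ : V → ℝ) z :=
  (Pi.single_nonneg (α := fun _ => ℝ)).2 (inv_nonneg.2 (Γ.mass_pos x).le) z

section Green

variable [Infinite V] [Γ.FiniteDegree] {U W : Finset V} {x y z : V}

theorem green_eq_zero (hz : z ∉ U) : Γ.green U x z = 0 := potential_eq_zero hz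

theorem green_nonneg (z : V) : 0 ≤ Γ.green U x z :=
  potential_nonneg (fun z _ => by classical exact green_source_nonneg x z) z

theorem superharmonicOn_green : Γ.SuperharmonicOn (Γ.green U x) U :=
  superharmonicOn_potential fun z _ => by classical exact green_source_nonneg x z

open Classical in
theorem harmonicOn_green : Γ.HarmonicOn (Γ.green U x) (U \ {x}) := fun _ hz =>
  (sub_eq_zero.1 ((potential_sub_markovOp hz.1).trans (Pi.single_eq_of_ne hz.2 _))).symm

theorem energyForm_green {b : V → ℝ} (hb : ∀ z ∉ U, b z = 0) :
    Γ.energyForm U (Γ.green U x) b = b x := by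
  classical
  have hterm : ∀ z ∈ U, (Γ.green U x z - Γ.markovOp (Γ.green U x) z) * b z * Γ.mass z =
      if z = x then b x else 0 := fun z hz => by
    rw [green, potential_sub_markovOp hz]
    split_ifs with hzx
    · subst hzx
      have := (Γ.mass_pos z).ne'
      rw [Pi.single_eq_same]
      field_simp
    · rw [Pi.single_eq_of_ne hzx, zero_mul, zero_mul]
  rw [energyForm_eq_sum fun z hz => green_eq_zero hz, Finset.sum_congr rfl hterm,
    Finset.sum_ite_eq', ite_eq_left_iff]
  exact fun hx => (hb x hx).symm

theorem green_comm (x y : V) : Γ.green U x y = Γ.green U y x := by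
  rw [← energyForm_green (Γ := Γ) (x := y) (b := Γ.green U x) fun z hz => green_eq_zero hz,
    energyForm_comm, energyForm_green fun z hz => green_eq_zero hz]

theorem sum_green_mul_eq_potential (U : Finset V) (x : V) (f : V → ℝ) :
    ∑ y ∈ U, Γ.green U x y * f y * Γ.mass y = Γ.potential U f x := by
  rw [← energyForm_green (Γ := Γ) (b := Γ.potential U f) fun z hz => potential_eq_zero hz,
    energyForm_comm,
    energyForm_eq_sum fun z hz => potential_eq_zero hz]
  refine Finset.sum_congr rfl fun z hz => ?_
  rw [potential_sub_markovOp hz, mul_comm (f z)]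

theorem green_self_pos (hx : x ∈ U) : 0 < Γ.green U x x := by
  classical
  have h : Γ.green U x x - Γ.markovOp (Γ.green U x) x = (Γ.mass x)⁻¹ :=
    (potential_sub_markovOp hx).trans (Pi.single_eq_same x _)
  have hP : 0 ≤ Γ.markovOp (Γ.green U x) x :=
    tsum_nonneg fun y => mul_nonneg (trans_nonneg x y) (green_nonneg y)
  linarith [inv_pos.2 (Γ.mass_pos x)]

theorem green_pos_of_weight_pos (hz : z ∈ U) (hzy : 0 < Γ.weight z y) (hy : 0 < Γ.green U x y) :
    0 < Γ.green U x z :=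
  (mul_pos (trans_pos hzy) hy).trans_le <|
    (trans_mul_le_markovOp (fun w _ => green_nonneg w) y).trans (superharmonicOn_green z hz)

theorem green_pos (hU : ∀ z, Γ.graph.dist x z ≤ Γ.graph.dist x y → z ∈ U) :
    0 < Γ.green U x y := by
  induction hn : Γ.graph.dist x y generalizing y with
  | zero =>
    obtain rfl := Γ.graph_connected.dist_eq_zero_iff.1 hn
    exact green_self_pos (hU x le_rfl)
  | succ n ih =>
    obtain ⟨z, hz, hzy⟩ := exists_weight_pos_of_dist_eq_succ hn
    exact green_pos_of_weight_pos (hU y le_rfl) (Γ.weight_symm z y ▸ hzy)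
      (ih (fun w hw => hU w (by omega)) hz)

end Green

/-! ### Resistance and the Green kernel -/

/-- The Dirichlet energies whose infimum is the inverse of `Γ.resistance A B`. -/
def energies (Γ : WeightedGraph V) (A B : Set V) : Set ℝ :=
  {q | ∃ f : V → ℝ, f.support.Finite ∧ (∀ x ∈ A, f x = 1) ∧ (∀ x ∈ B, f x = 0) ∧
    q = Γ.innerMu (-Γ.laplacian f) f}

theorem resistance_eq (A B : Set V) : Γ.resistance A B = (sInf (Γ.energies A B))⁻¹ := rfl

theorem mem_energies_compl [Nontrivial V] {U : Finset V} {A : Set V} {q : ℝ} :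
    q ∈ Γ.energies A (U : Set V)ᶜ ↔
      ∃ f : V → ℝ, (∀ z ∈ A, f z = 1) ∧ (∀ z ∉ U, f z = 0) ∧
        q = Γ.energyForm U f f := by
  constructor
  · rintro ⟨f, -, hf₁, hf₀, rfl⟩
    exact ⟨f, hf₁, hf₀, innerMu_neg_laplacian hf₀⟩
  · rintro ⟨f, hf₁, hf₀, rfl⟩
    exact ⟨f, U.finite_toSet.subset fun z hz => by_contra fun hzU => hz (hf₀ z hzU), hf₁, hf₀,
      (innerMu_neg_laplacian hf₀).symm⟩

/-- The Green kernel truncated at the level `m`; this is `m` times the equilibrium potential of the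
superlevel set `{m ≤ g^U(x, ·)}`. -/
noncomputable def truncatedGreen (Γ : WeightedGraph V) [Infinite V] [Γ.FiniteDegree]
    (U : Finset V) (x : V) (m : ℝ) : V → ℝ := fun z => min (Γ.green U x z) m

section Resistance

variable [Infinite V] [Γ.FiniteDegree] {U : Finset V} {x : V} {A : Set V}

theorem truncatedGreen_eq_zero {m : ℝ} (hm : 0 ≤ m) {z : V} (hz : z ∉ U) :
    Γ.truncatedGreen U x m z = 0 := by
  rw [truncatedGreen, green_eq_zero hz, min_eq_left hm]

theorem energyForm_truncatedGreen_self_le {m : ℝ} (hm : 0 ≤ m) :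
    Γ.energyForm U (Γ.truncatedGreen U x m) (Γ.truncatedGreen U x m) ≤ m := by
  have hzero : ∀ z ∉ U, Γ.truncatedGreen U x m z = 0 := fun z hz => truncatedGreen_eq_zero hm hz
  have hsuper : Γ.SuperharmonicOn (Γ.truncatedGreen U x m) U :=
    superharmonicOn_green.inf_const m
  calc Γ.energyForm U (Γ.truncatedGreen U x m) (Γ.truncatedGreen U x m)
      ≤ Γ.energyForm U (Γ.truncatedGreen U x m) (Γ.green U x) := by
        rw [energyForm_eq_sum hzero, energyForm_eq_sum hzero]
        refine Finset.sum_le_sum fun z hz => mul_le_mul_of_nonneg_right ?_ (Γ.mass_pos z).le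
        exact mul_le_mul_of_nonneg_left (min_le_left _ _) (sub_nonneg.2 (hsuper z hz))
    _ = Γ.truncatedGreen U x m x := by rw [energyForm_comm, energyForm_green hzero]
    _ ≤ m := min_le_right _ _

-- Off `A` the truncation does nothing, and near `{M < g}` the function `f` is constant.
theorem energyForm_truncatedGreen_eq_one {M : ℝ} (hxA : x ∈ A)
    (hMA : Γ.closedNbhd {z | M < Γ.green U x z} ⊆ A) {f : V → ℝ} (hf₁ : ∀ z ∈ A, f z = 1)
    (hf₀ : ∀ z ∉ U, f z = 0) : Γ.energyForm U (Γ.truncatedGreen U x M) f = 1 := by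
  have hdiff : Γ.energyForm U f (Γ.green U x - Γ.truncatedGreen U x M) = 0 := by
    rw [energyForm_eq_sum hf₀]
    refine Finset.sum_eq_zero fun z _ => ?_
    rcases lt_or_ge M (Γ.green U x z) with hz | hz
    · have hPf : Γ.markovOp f z = 1 := by
        rw [← markovOp_const (Γ := Γ) 1 z]
        have hnear : ∀ y, 0 < Γ.weight z y → f y = 1 := fun y hy => hf₁ y (hMA (.inr ⟨z, hz, hy⟩))
        exact le_antisymm (markovOp_mono fun y hy => (hnear y hy).le)
          (markovOp_mono fun y hy => (hnear y hy).ge)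
      rw [hPf, hf₁ z (hMA (.inl hz)), sub_self, zero_mul, zero_mul]
    · rw [Pi.sub_apply, truncatedGreen, min_eq_left hz, sub_self, mul_zero, zero_mul]
  rw [map_sub, sub_eq_zero] at hdiff
  rw [energyForm_comm, ← hdiff, energyForm_comm, energyForm_green hf₀, hf₁ x hxA]

theorem inv_mem_lowerBounds_energies {M : ℝ} (hM : 0 < M) (hxA : x ∈ A)
    (hMA : Γ.closedNbhd {z | M < Γ.green U x z} ⊆ A) :
    M⁻¹ ∈ lowerBounds (Γ.energies A (U : Set V)ᶜ) := fun q hq => by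
  obtain ⟨f, hf₁, hf₀, rfl⟩ := mem_energies_compl.1 hq
  have hCS := sq_energyForm_le (Γ := Γ) U (Γ.truncatedGreen U x M) f
  rw [energyForm_truncatedGreen_eq_one hxA hMA hf₁ hf₀, one_pow] at hCS
  rw [inv_le_iff_one_le_mul₀' hM]
  exact hCS.trans (mul_le_mul_of_nonneg_right (energyForm_truncatedGreen_self_le hM.le)
    (energyForm_self_nonneg U f))

theorem exists_energies_le_inv {m : ℝ} (hm : 0 < m) (hmA : ∀ z ∈ A, m ≤ Γ.green U x z) :
    ∃ q ∈ Γ.energies A (U : Set V)ᶜ, q ≤ m⁻¹ := by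
  refine ⟨_, mem_energies_compl.2 ⟨m⁻¹ • Γ.truncatedGreen U x m, fun z hz => ?_, fun z hz => ?_,
    rfl⟩, ?_⟩
  · rw [Pi.smul_apply, truncatedGreen, min_eq_right (hmA z hz), smul_eq_mul, inv_mul_cancel₀ hm.ne']
  · rw [Pi.smul_apply, truncatedGreen_eq_zero hm.le hz, smul_zero]
  · rw [LinearMap.map_smul₂, map_smul, smul_eq_mul, smul_eq_mul]
    calc m⁻¹ * (m⁻¹ * Γ.energyForm U (Γ.truncatedGreen U x m) (Γ.truncatedGreen U x m))
        ≤ m⁻¹ * (m⁻¹ * m) := by gcongr; exact energyForm_truncatedGreen_self_le hm.le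
      _ = m⁻¹ := by rw [inv_mul_cancel₀ hm.ne', mul_one]

theorem resistance_mem_Icc (hxA : x ∈ A) {m M : ℝ} (hm : 0 < m) (hM : 0 < M)
    (hmA : ∀ z ∈ A, m ≤ Γ.green U x z) (hMA : Γ.closedNbhd {z | M < Γ.green U x z} ⊆ A) :
    Γ.resistance A (U : Set V)ᶜ ∈ Set.Icc m M := by
  have hlower := inv_mem_lowerBounds_energies hM hxA hMA
  obtain ⟨q, hq, hqm⟩ := exists_energies_le_inv hm hmA
  have hinf : M⁻¹ ≤ sInf (Γ.energies A (U : Set V)ᶜ) := le_csInf ⟨q, hq⟩ hlower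
  have hpos := (inv_pos.2 hM).trans_le hinf
  rw [resistance_eq]
  exact ⟨(le_inv_comm₀ hm hpos).2 ((csInf_le ⟨_, hlower⟩ hq).trans hqm),
    (inv_le_comm₀ hpos hM).2 hinf⟩

end Resistance

/-! ### The mean exit time as a potential -/

/-- The trajectories that stay in `A` up to time `k`, that is, the event `k < T_A`. -/
def staysUpTo (A : Set V) (k : ℕ) : Set (ℕ → V) := {ω | ∀ i ≤ k, ω i ∈ A}

theorem staysUpTo_eq_preimage (A : Set V) (k : ℕ) :
    staysUpTo A k = Preorder.frestrictLe k ⁻¹' (Set.univ.pi fun _ => A) := by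
  ext ω
  simp [staysUpTo, Set.mem_pi]

theorem staysUpTo_succ (A : Set V) (k : ℕ) :
    staysUpTo A (k + 1) = {ω | ω (k + 1) ∈ A} ∩ staysUpTo A k := by
  ext ω
  simp only [staysUpTo, Set.mem_ofPred_eq, Set.mem_inter_iff, Nat.le_succ_iff, or_imp,
    forall_and, forall_eq, and_comm]

theorem exitTime_eq_tsum (A : Set V) (ω : ℕ → V) :
    exitTime A ω = ∑' k, (staysUpTo A k).indicator 1 ω := by
  classical
  by_cases h : ∃ k, ω k ∉ A
  · have hmem : ∀ k, ω ∈ staysUpTo A k ↔ k < Nat.find h := fun k => by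
      simp [staysUpTo, Nat.lt_find_iff]
    have hexit : exitTime A ω = Nat.find h :=
      le_antisymm (iInf₂_le (Nat.find h) (Nat.find_spec h))
        (le_iInf₂ fun k hk => Nat.cast_le.2 (Nat.find_min' h hk))
    rw [hexit, tsum_eq_sum (s := Finset.range (Nat.find h)) fun k hk =>
        Set.indicator_of_notMem (by simpa [hmem] using hk) _,
      Finset.sum_congr rfl fun k hk =>
        Set.indicator_of_mem ((hmem k).2 (Finset.mem_range.1 hk)) _]
    simp
  · push Not at h
    have hmem : ∀ k, ω ∈ staysUpTo A k := fun k i _ => h i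
    simp [exitTime, h, hmem]

section ExitTime

variable [MeasurableSpace V] [DiscreteMeasurableSpace V]

theorem measurableSet_staysUpTo [Countable V] (A : Set V) (k : ℕ) :
    MeasurableSet (staysUpTo A k) := by
  rw [staysUpTo_eq_preimage]
  exact (Preorder.measurable_frestrictLe k) (.of_discrete)

theorem meanExitFrom_eq_tsum [Countable V] [Nontrivial V] (z : V) (A : Set V) :
    Γ.meanExitFrom z A = ∑' k, Γ.walkLaw z (staysUpTo A k) := by
  have hmeas : ∀ k, Measurable ((staysUpTo A k).indicator (1 : (ℕ → V) → ℝ≥0∞)) :=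
    fun k => measurable_one.indicator (measurableSet_staysUpTo A k)
  simp only [meanExitFrom, exitTime_eq_tsum]
  rw [lintegral_tsum fun k => (hmeas k).aemeasurable]
  exact tsum_congr fun k => lintegral_indicator_one (measurableSet_staysUpTo A k)

theorem lintegral_stepKernel [Countable V] [Nontrivial V] (x : V) (f : V → ℝ≥0∞) :
    ∫⁻ y, f y ∂Γ.stepKernel x = ∑' y, ENNReal.ofReal (Γ.trans x y) * f y := by
  rw [lintegral_countable']
  refine tsum_congr fun y => ?_
  rw [mul_comm]
  congr 1
  exact (Γ.stepPMF x).toMeasure_apply_singleton y (.singleton y)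

theorem lintegral_stepKernel_ofReal [Countable V] [Nontrivial V] [Γ.FiniteDegree] {f : V → ℝ}
    (hf : ∀ y, 0 ≤ f y) (x : V) :
    ∫⁻ y, ENNReal.ofReal (f y) ∂Γ.stepKernel x = ENNReal.ofReal (Γ.markovOp f x) := by
  simp only [lintegral_stepKernel, ← ENNReal.ofReal_mul (trans_nonneg x _)]
  exact (ENNReal.ofReal_tsum_of_nonneg (fun y => mul_nonneg (trans_nonneg x y) (hf y))
    (summable_trans_mul f x)).symm

theorem lintegral_walkLaw_zero [Nontrivial V] (z : V) (f : V → ℝ≥0∞) :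
    ∫⁻ ω, f (ω 0) ∂Γ.walkLaw z = f z := by
  have hf : Measurable fun ω : ℕ → V => f (ω 0) :=
    Measurable.of_discrete.comp (measurable_pi_apply 0)
  rw [walkLaw, Kernel.lintegral_traj _ hf]
  simp [Function.updateFinset]

theorem markov_property [Countable V] [Nontrivial V] (z : V) (k : ℕ)
    (B : Set ((_ : Finset.Iic k) → V)) (f : V → ℝ≥0∞) :
    ∫⁻ ω in Preorder.frestrictLe k ⁻¹' B, f (ω (k + 1)) ∂Γ.walkLaw z =
      ∫⁻ ω in Preorder.frestrictLe k ⁻¹' B, ∫⁻ y, f y ∂Γ.stepKernel (ω k) ∂Γ.walkLaw z := by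
  have hpair : Measurable fun ω : ℕ → V =>
      (Preorder.frestrictLe (π := fun _ => V) k ω, ω (k + 1)) := by fun_prop
  calc ∫⁻ ω in Preorder.frestrictLe k ⁻¹' B, f (ω (k + 1)) ∂Γ.walkLaw z
      = ∫⁻ p in B ×ˢ Set.univ, f p.2 ∂(Γ.walkLaw z).map
          fun ω => (Preorder.frestrictLe k ω, ω (k + 1)) := by
        rw [setLIntegral_map .of_discrete .of_discrete hpair, Set.prod_univ]
        rfl
    _ = ∫⁻ h in B, ∫⁻ y, f y ∂Γ.historyKernel k h
          ∂Kernel.partialTraj (X := fun _ => V) Γ.historyKernel 0 k fun _ => z := by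
        rw [walkLaw, ← Kernel.partialTraj_compProd_eq_map_traj (Nat.zero_le k),
          Measure.setLIntegral_compProd .of_discrete .of_discrete .univ]
        simp only [Measure.restrict_univ]
    _ = ∫⁻ ω in Preorder.frestrictLe k ⁻¹' B, ∫⁻ y, f y ∂Γ.stepKernel (ω k) ∂Γ.walkLaw z := by
        rw [← Kernel.traj_map_frestrictLe_apply,
          setLIntegral_map .of_discrete .of_discrete (Preorder.measurable_frestrictLe k)]
        rfl

theorem setLIntegral_staysUpTo_succ [Countable V] [Nontrivial V] (A : Set V) (z : V) (k : ℕ)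
    {f : V → ℝ≥0∞} (hf : ∀ y ∉ A, f y = 0) :
    ∫⁻ ω in staysUpTo A (k + 1), f (ω (k + 1)) ∂Γ.walkLaw z =
      ∫⁻ ω in staysUpTo A k, ∫⁻ y, f y ∂Γ.stepKernel (ω k) ∂Γ.walkLaw z := by
  have hA : MeasurableSet {ω : ℕ → V | ω (k + 1) ∈ A} :=
    measurable_pi_apply (k + 1) (.of_discrete)
  rw [staysUpTo_eq_preimage A k, ← markov_property, ← staysUpTo_eq_preimage,
    staysUpTo_succ, ← Measure.restrict_restrict hA]
  exact setLIntegral_eq_of_support_subset fun ω hω => by_contra fun h => hω (hf _ h)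

variable [Countable V] [Infinite V] [Γ.FiniteDegree] {U : Finset V}

theorem setLIntegral_staysUpTo_potential_one (U : Finset V) (z : V) (k : ℕ) :
    ∫⁻ ω in staysUpTo U k, ENNReal.ofReal (Γ.potential U 1 (ω k)) ∂Γ.walkLaw z =
      Γ.walkLaw z (staysUpTo U k) +
        ∫⁻ ω in staysUpTo U (k + 1), ENNReal.ofReal (Γ.potential U 1 (ω (k + 1))) ∂Γ.walkLaw z := by
  have he : ∀ y, 0 ≤ Γ.potential U 1 y := potential_nonneg fun _ _ => zero_le_one
  rw [setLIntegral_staysUpTo_succ (f := fun y => ENNReal.ofReal (Γ.potential U 1 y)) U z k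
    fun y hy => by rw [potential_eq_zero hy, ENNReal.ofReal_zero], ← setLIntegral_one,
    ← lintegral_add_left measurable_const]
  refine setLIntegral_congr_fun (measurableSet_staysUpTo _ k) fun ω hω => ?_
  have hone := potential_sub_markovOp (Γ := Γ) (f := 1) (hω k le_rfl)
  have hP : 0 ≤ Γ.markovOp (Γ.potential U 1) (ω k) :=
    tsum_nonneg fun y => mul_nonneg (trans_nonneg _ y) (he y)
  rw [lintegral_stepKernel_ofReal he, ← ENNReal.ofReal_one, ← ENNReal.ofReal_add zero_le_one hP,
    sub_eq_iff_eq_add.1 hone, Pi.one_apply]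

theorem potential_one_eq_sum_add (U : Finset V) (z : V) (N : ℕ) :
    ENNReal.ofReal (Γ.potential U 1 z) = ∑ k ∈ Finset.range N, Γ.walkLaw z (staysUpTo U k) +
      ∫⁻ ω in staysUpTo U N, ENNReal.ofReal (Γ.potential U 1 (ω N)) ∂Γ.walkLaw z := by
  induction N with
  | zero =>
    rw [Finset.range_zero, Finset.sum_empty, zero_add, setLIntegral_eq_of_support_subset]
    · exact (lintegral_walkLaw_zero z fun y => ENNReal.ofReal (Γ.potential U 1 y)).symm
    · intro ω hω i hi
      rw [Nat.le_zero.1 hi]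
      exact by_contra fun h => hω (by simp only [potential_eq_zero h, ENNReal.ofReal_zero])
  | succ N ih =>
    rw [ih, Finset.sum_range_succ, setLIntegral_staysUpTo_potential_one, add_assoc]

theorem meanExitFrom_eq_potential_one (U : Finset V) (z : V) :
    Γ.meanExitFrom z U = ENNReal.ofReal (Γ.potential U 1 z) := by
  set T : ℕ → ℝ≥0∞ := fun k => Γ.walkLaw z (staysUpTo U k)
  set S : ℕ → ℝ≥0∞ := fun k =>
    ∫⁻ ω in staysUpTo U k, ENNReal.ofReal (Γ.potential U 1 (ω k)) ∂Γ.walkLaw z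
  have hsum : ∀ N, ENNReal.ofReal (Γ.potential U 1 z) = ∑ k ∈ Finset.range N, T k + S N :=
    potential_one_eq_sum_add U z
  have hT : ∑' k, T k ≠ ∞ := ne_top_of_le_ne_top ENNReal.ofReal_ne_top <|
    ENNReal.tsum_le_of_sum_range_le fun N => (hsum N).ge.trans' le_self_add
  obtain ⟨B, hB⟩ := (U.finite_toSet.image (Γ.potential U 1)).bddAbove
  have hST : ∀ N, S N ≤ ENNReal.ofReal B * T N := fun N =>
    (setLIntegral_mono measurable_const fun ω (hω : ω ∈ staysUpTo U N) =>
      ENNReal.ofReal_le_ofReal (hB ⟨ω N, hω N le_rfl, rfl⟩)).trans_eq (setLIntegral_const _ _)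
  have hBT : Filter.Tendsto (fun N => ENNReal.ofReal B * T N) Filter.atTop (nhds 0) := by
    simpa only [mul_zero] using ENNReal.Tendsto.const_mul
      (ENNReal.tendsto_atTop_zero_of_tsum_ne_top hT) (.inr ENNReal.ofReal_ne_top)
  have hS : Filter.Tendsto S Filter.atTop (nhds 0) :=
    tendsto_of_tendsto_of_tendsto_of_le_of_le tendsto_const_nhds hBT (fun _ => zero_le) hST
  have hlim := (ENNReal.tendsto_nat_tsum T).add hS
  simp only [← hsum, add_zero] at hlim
  rw [meanExitFrom_eq_tsum]
  exact tendsto_nhds_unique hlim tendsto_const_nhds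

end ExitTime

/-! ### The Harnack inequality for the Green kernel -/

/-- `K` is an admissible constant both in the elliptic Harnack inequality and in the comparison
of a positive superharmonic function at neighbouring vertices. -/
structure HarnackConst (Γ : WeightedGraph V) (K : ℝ) : Prop where
  one_le : 1 ≤ K
  one_le_mul_trans : ∀ x y : V, 0 < Γ.weight x y → 1 ≤ K * Γ.trans x y
  harnack : ∀ (x : V) (R : ℝ), 0 < R → ∀ u : V → ℝ, (∀ y, 0 ≤ u y) →
    Γ.HarmonicOn u (Γ.ball x (2 * R)) → ∀ y ∈ Γ.ball x R, ∀ z ∈ Γ.ball x R, u y ≤ K * u z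

theorem ControlledWeights.exists_harnackConst (hp : Γ.ControlledWeights) (hH : Γ.EllipticHarnack) :
    ∃ K, Γ.HarnackConst K := by
  obtain ⟨p₀, hp₀, hp⟩ := hp
  obtain ⟨H, hH₁, hH⟩ := hH
  have hp_le : p₀⁻¹ ≤ max H p₀⁻¹ := le_max_right _ _
  refine ⟨max H p₀⁻¹, hH₁.le.trans (le_max_left _ _), fun x y hxy => ?_,
    fun x R hR u hu hharm y hy z hz => ?_⟩
  · calc (1 : ℝ) = p₀⁻¹ * p₀ := (inv_mul_cancel₀ hp₀.ne').symm
      _ ≤ max H p₀⁻¹ * Γ.trans x y :=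
        mul_le_mul hp_le (hp x y hxy) hp₀.le ((inv_pos.2 hp₀).le.trans hp_le)
  · exact (hH x R hR u (fun y _ => hu y) hharm y hy z hz).trans
      (mul_le_mul_of_nonneg_right (le_max_left _ _) (hu z))

theorem HarnackConst.pos {K : ℝ} (hK : Γ.HarnackConst K) : 0 < K := zero_lt_one.trans_le hK.one_le

section Harnack

variable [Infinite V] [Γ.FiniteDegree] {K : ℝ} {U : Finset V} {x y y' z q q' : V}

theorem HarnackConst.green_le_mul_of_dist_le_one (hK : Γ.HarnackConst K) (hq' : q' ∈ U)
    (hd : Γ.graph.dist q' q ≤ 1) : Γ.green U y q ≤ K * Γ.green U y q' := by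
  rcases eq_or_ne q' q with rfl | hne
  · exact le_mul_of_one_le_left (green_nonneg _) hK.one_le
  · have hadj : Γ.graph.Adj q' q := SimpleGraph.dist_eq_one_iff_adj.1
      (le_antisymm hd (Γ.graph_connected.pos_dist_of_ne hne))
    calc Γ.green U y q ≤ K * Γ.trans q' q * Γ.green U y q :=
          le_mul_of_one_le_left (green_nonneg q) (hK.one_le_mul_trans q' q (graph_adj.1 hadj).2)
      _ = K * (Γ.trans q' q * Γ.green U y q) := mul_assoc _ _ _
      _ ≤ K * Γ.green U y q' := mul_le_mul_of_nonneg_left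
          ((trans_mul_le_markovOp (fun w _ => green_nonneg w) q).trans
            (superharmonicOn_green q' hq')) hK.pos.le

theorem HarnackConst.green_le_mul_of_mem_ball (hK : Γ.HarnackConst K) {w : V} {r : ℝ}
    (hU : Γ.ball w (2 * r) ⊆ U) (hy : y ∉ Γ.ball w (2 * r)) (hq : q ∈ Γ.ball w r)
    (hq' : q' ∈ Γ.ball w r) : Γ.green U y q ≤ K * Γ.green U y q' :=
  hK.harnack w r ((Nat.cast_nonneg _).trans_lt hq) _ green_nonneg
    (harmonicOn_green.mono fun v hv => ⟨hU hv, by rintro rfl; exact hy hv⟩) q hq q' hq'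

theorem HarnackConst.green_le_mul_and_le_mul (hK : Γ.HarnackConst K)
    (hU : ∀ z, Γ.graph.dist q z ≤ 2 * Γ.graph.dist q q' → z ∈ U)
    (hd : Γ.graph.dist q q' ≤ 1 ∨ 2 * Γ.graph.dist q q' < Γ.graph.dist q y) :
    Γ.green U y q ≤ K * Γ.green U y q' ∧ Γ.green U y q' ≤ K * Γ.green U y q := by
  rcases hd with hd | hd
  · exact ⟨hK.green_le_mul_of_dist_le_one (hU q' (by omega)) (by rwa [SimpleGraph.dist_comm]),
      hK.green_le_mul_of_dist_le_one (hU q (by simp)) hd⟩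
  · set r : ℝ := Γ.graph.dist q q' + 1 / 2 with hr
    have hball : ∀ z, z ∈ Γ.ball q (2 * r) ↔ Γ.graph.dist q z ≤ 2 * Γ.graph.dist q q' :=
      fun z => by
        rw [mem_ball, ← Nat.lt_succ_iff, ← Nat.cast_lt (α := ℝ)]
        push_cast
        rw [hr, mul_add, mul_one_div_cancel two_ne_zero]
    have hUr : Γ.ball q (2 * r) ⊆ U := fun z hz => hU z ((hball z).1 hz)
    have hy : y ∉ Γ.ball q (2 * r) := fun h => hd.not_ge ((hball y).1 h)
    have hq : q ∈ Γ.ball q r := self_mem_ball q (by positivity)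
    have hq' : q' ∈ Γ.ball q r := by rw [mem_ball]; linarith
    exact ⟨hK.green_le_mul_of_mem_ball hUr hy hq hq', hK.green_le_mul_of_mem_ball hUr hy hq' hq⟩

-- The points at distance `i k / 16` from `x` on a geodesic to `y'`, `i ≤ 16`, form a Harnack chain:
-- the geodesic stays at distance at least `k / 4` from `y`.
theorem HarnackConst.green_center_le_mul_and_le_mul (hK : Γ.HarnackConst K) {k : ℕ}
    (hy : Γ.graph.dist x y = k) (hy' : Γ.graph.dist x y' = k) (hyy' : k ≤ 2 * Γ.graph.dist y y')
    (hU : ∀ z, Γ.graph.dist x z ≤ 2 * k → z ∈ U) :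
    Γ.green U y x ≤ K ^ 16 * Γ.green U y y' ∧ Γ.green U y y' ≤ K ^ 16 * Γ.green U y x := by
  obtain ⟨p, hp₀, hpk, hp⟩ := exists_geodesic Γ x y'
  rw [hy'] at hpk hp
  have hdist : ∀ i ≤ k, Γ.graph.dist x (p i) = i := fun i hi => by
    simpa only [hp₀, Nat.sub_zero] using hp 0 i (Nat.zero_le _) hi
  have hfar : ∀ i ≤ k, k ≤ 4 * Γ.graph.dist (p i) y := fun i hi => by
    have h₁ := Γ.graph_connected.dist_triangle (u := x) (v := p i) (w := y)
    have h₂ := Γ.graph_connected.dist_triangle (u := y) (v := p i) (w := y')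
    have h₃ := hp i k hi le_rfl
    rw [hpk] at h₃
    rw [SimpleGraph.dist_comm (u := y) (v := p i)] at h₂
    have h₄ := hdist i hi
    omega
  set g : ℕ → ℝ := fun i => Γ.green U y (p (i * k / 16)) with hg
  have hstep : ∀ i < 16, g i ≤ K * g (i + 1) ∧ g (i + 1) ≤ K * g i := fun i hi => by
    have hik : (i + 1) * k ≤ 16 * k := Nat.mul_le_mul_right k hi
    have hsucc : (i + 1) * k = i * k + k := Nat.succ_mul i k
    have hd := hp (i * k / 16) ((i + 1) * k / 16) (by omega) (by omega)
    have hi := hdist (i * k / 16) (by omega)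
    refine hK.green_le_mul_and_le_mul (fun z hz => hU z ?_) ?_
    · have := Γ.graph_connected.dist_triangle (u := x) (v := p (i * k / 16)) (w := z)
      omega
    · have := hfar (i * k / 16) (by omega)
      omega
  have hg₀ : g 0 = Γ.green U y x := by simp only [hg, zero_mul, Nat.zero_div, hp₀]
  have hg₁₆ : g 16 = Γ.green U y y' := by
    simp only [hg, Nat.mul_div_cancel_left k (by norm_num : 0 < 16), hpk]
  rw [← hg₀, ← hg₁₆, ← inv_mul_le_iff₀ (pow_pos hK.pos 16), ← inv_pow]
  exact ⟨geom_le (inv_pos.2 hK.pos).le 16 fun i hi => (inv_mul_le_iff₀ hK.pos).2 (hstep i hi).1,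
    le_geom hK.pos.le 16 fun i hi => (hstep i hi).2⟩

-- If `y` and `y'` are far apart, then
-- `g(x, y) = g(y, x) ≈ g(y, y') = g(y', y) ≈ g(y', x) = g(x, y')`.
theorem HarnackConst.green_le_mul_of_dist_eq (hK : Γ.HarnackConst K) {k : ℕ}
    (hy : Γ.graph.dist x y = k) (hy' : Γ.graph.dist x y' = k)
    (hU : ∀ z, Γ.graph.dist x z ≤ 2 * k → z ∈ U) :
    Γ.green U x y ≤ K ^ 32 * Γ.green U x y' := by
  rcases lt_or_ge (2 * Γ.graph.dist y y') k with hnear | hfar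
  · have hUy : ∀ z, Γ.graph.dist y z ≤ 2 * Γ.graph.dist y y' → z ∈ U := fun z hz => hU z <| by
      have := Γ.graph_connected.dist_triangle (u := x) (v := y) (w := z)
      omega
    have hstep := (hK.green_le_mul_and_le_mul (y := x) hUy
      (.inr (by rwa [SimpleGraph.dist_comm (u := y) (v := x), hy]))).1
    exact hstep.trans <| mul_le_mul_of_nonneg_right
      (le_self_pow₀ hK.one_le (by norm_num)) (green_nonneg y')
  · calc Γ.green U x y = Γ.green U y x := green_comm x y
      _ ≤ K ^ 16 * Γ.green U y y' := (hK.green_center_le_mul_and_le_mul hy hy' hfar hU).1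
      _ = K ^ 16 * Γ.green U y' y := by rw [green_comm]
      _ ≤ K ^ 16 * (K ^ 16 * Γ.green U y' x) := mul_le_mul_of_nonneg_left
          (hK.green_center_le_mul_and_le_mul hy' hy (by rwa [SimpleGraph.dist_comm]) hU).2
          (pow_nonneg hK.pos.le 16)
      _ = K ^ 32 * Γ.green U x y' := by rw [← mul_assoc, ← pow_add, green_comm]

theorem green_le_of_le_dist {n : ℕ} {c : ℝ} (hc : ∀ w, Γ.graph.dist x w = n → Γ.green U x w ≤ c)
    (hz : n ≤ Γ.graph.dist x z) : Γ.green U x z ≤ c := by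
  classical
  rcases hz.eq_or_lt with hz | hz
  · exact hc z hz.symm
  have hc₀ : 0 ≤ c := by
    obtain ⟨w, hw⟩ := exists_dist_eq (Γ := Γ) x n
    exact (green_nonneg w).trans (hc w hw)
  by_cases hzU : z ∈ U
  · refine HarmonicOn.le_of_boundary (U := U.filter (n < Γ.graph.dist x ·))
      (harmonicOn_green.mono fun w hw => ?_) (fun w hw => ?_) (Finset.mem_filter.2 ⟨hzU, hz⟩)
    · have hw := Finset.mem_filter.1 (Finset.mem_coe.1 hw)
      exact ⟨hw.1, fun h => by simp [Set.mem_singleton_iff.1 h] at hw⟩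
    · by_cases hwU : w ∈ U
      · have hwn : Γ.graph.dist x w ≤ n := not_lt.1 fun h => hw.2 (Finset.mem_filter.2 ⟨hwU, h⟩)
        obtain hw' | ⟨v, hv, hvw⟩ := hw.1
        · exact absurd hw' hw.2
        · have := (Finset.mem_filter.1 (Finset.mem_coe.1 hv)).2
          have := dist_le_succ_of_weight_pos x (Γ.weight_symm v w ▸ hvw)
          exact hc w (by omega)
      · exact (green_eq_zero hwU).trans_le hc₀
  · exact (green_eq_zero hzU).trans_le hc₀

theorem HarnackConst.green_le_mul_of_dist_le (hK : Γ.HarnackConst K)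
    (hU : ∀ w, Γ.graph.dist x w ≤ 2 * Γ.graph.dist x y → w ∈ U)
    (hyz : Γ.graph.dist x y ≤ Γ.graph.dist x z) :
    Γ.green U x z ≤ K ^ 32 * Γ.green U x y :=
  green_le_of_le_dist (fun _ hw => hK.green_le_mul_of_dist_eq hw rfl hU) hyz

end Harnack

/-! ### Balls and their volumes -/

theorem mass_nonneg (x : V) : 0 ≤ Γ.mass x := tsum_nonneg (Γ.weight_nonneg x)

theorem vol_nonneg (x : V) (R : ℝ) : 0 ≤ Γ.vol x R := tsum_nonneg fun y => mass_nonneg y.1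

theorem annulusVol_le_vol (x : V) (r R : ℝ) : Γ.annulusVol x r R ≤ Γ.vol x R :=
  sub_le_self _ (vol_nonneg x r)

theorem vol_two_pow_mul_le {D : ℝ} (hD : 0 ≤ D)
    (hV : ∀ (x : V) (R : ℝ), 0 < R → Γ.vol x (2 * R) ≤ D * Γ.vol x R) (x : V) {R : ℝ}
    (hR : 0 < R) (n : ℕ) :
    Γ.vol x (2 ^ n * R) ≤ D ^ n * Γ.vol x R := by
  induction n with
  | zero => simp
  | succ n ih =>
    calc Γ.vol x (2 ^ (n + 1) * R) = Γ.vol x (2 * (2 ^ n * R)) := by ring_nf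
      _ ≤ D * Γ.vol x (2 ^ n * R) := hV x _ (by positivity)
      _ ≤ D * (D ^ n * Γ.vol x R) := mul_le_mul_of_nonneg_left ih hD
      _ = D ^ (n + 1) * Γ.vol x R := by ring

section Balls

variable [Γ.FiniteDegree] {x y z : V} {r R : ℝ}

/-- The ball `B(x,R)` as a finite set, the form in which the potential theory of the walk killed on
leaving it takes it. -/
noncomputable def ballFinset (Γ : WeightedGraph V) [Γ.FiniteDegree] (x : V) (R : ℝ) : Finset V :=
  (finite_ball (Γ := Γ) x R).toFinset

theorem mem_ballFinset : y ∈ Γ.ballFinset x R ↔ (Γ.graph.dist x y : ℝ) < R :=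
  Set.Finite.mem_toFinset _

theorem coe_ballFinset (x : V) (R : ℝ) : (Γ.ballFinset x R : Set V) = Γ.ball x R :=
  Set.Finite.coe_toFinset _

theorem ballFinset_subset (h : (Γ.graph.dist y x : ℝ) + r ≤ R) :
    Γ.ballFinset x r ⊆ Γ.ballFinset y R := fun z hz => by
  rw [mem_ballFinset] at hz ⊢
  have : (Γ.graph.dist y z : ℝ) ≤ Γ.graph.dist y x + Γ.graph.dist x z :=
    mod_cast Γ.graph_connected.dist_triangle (u := y) (v := x) (w := z)
  linarith

theorem ballFinset_mono (x : V) (h : r ≤ R) : Γ.ballFinset x r ⊆ Γ.ballFinset x R :=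
  ballFinset_subset (by simpa using h)

theorem vol_eq_sum (x : V) (R : ℝ) : Γ.vol x R = ∑ y ∈ Γ.ballFinset x R, Γ.mass y := by
  rw [vol, ← coe_ballFinset]
  exact Finset.tsum_subtype' _ _

theorem vol_le_vol (h : (Γ.graph.dist y x : ℝ) + r ≤ R) : Γ.vol x r ≤ Γ.vol y R := by
  rw [vol_eq_sum, vol_eq_sum]
  exact Finset.sum_le_sum_of_subset_of_nonneg (ballFinset_subset h) fun z _ _ => mass_nonneg z

theorem vol_le_annulusVol {s : ℝ} (hsR : s ≤ R) (h : Γ.ball y r ⊆ Γ.ball x R \ Γ.ball x s) :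
    Γ.vol y r ≤ Γ.annulusVol x s R := by
  classical
  rw [annulusVol, vol_eq_sum, vol_eq_sum, vol_eq_sum,
    ← Finset.sum_sdiff_eq_sub (ballFinset_mono x hsR)]
  refine Finset.sum_le_sum_of_subset_of_nonneg (fun z hz => ?_) fun z _ _ => mass_nonneg z
  rw [Finset.mem_sdiff, mem_ballFinset, mem_ballFinset]
  exact h (mem_ballFinset.1 hz)

theorem exists_ball_subset_annulus [Infinite V] (x : V) (hR : 1 / 2 < R) :
    ∃ y ∈ Γ.ball x (2 * R), Γ.ball y (R / 4) ⊆ Γ.ball x (2 * R) \ Γ.ball x R := by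
  rcases lt_or_ge R 2 with hR₂ | hR₂
  · obtain ⟨y, hy⟩ := exists_dist_eq (Γ := Γ) x ⌈R⌉₊
    have hceil : (⌈R⌉₊ : ℝ) < 2 * R := by
      rcases le_or_gt R 1 with hR₁ | hR₁
      · have : (⌈R⌉₊ : ℝ) ≤ 1 := by exact_mod_cast Nat.ceil_le.2 (by simpa using hR₁)
        linarith
      · have : (⌈R⌉₊ : ℝ) ≤ 2 := by exact_mod_cast Nat.ceil_le.2 (by simpa using hR₂.le)
        linarith
    have hyR : y ∈ Γ.ball x (2 * R) := by rwa [mem_ball, hy]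
    refine ⟨y, hyR, fun z hz => ?_⟩
    have hyz : Γ.graph.dist y z = 0 := Nat.lt_one_iff.1 <| by
      rw [mem_ball] at hz
      exact_mod_cast hz.trans (by linarith : R / 4 < 1)
    obtain rfl := Γ.graph_connected.dist_eq_zero_iff.1 hyz
    exact ⟨hyR, fun h => (Nat.le_ceil R).not_gt (by rwa [mem_ball, hy] at h)⟩
  · obtain ⟨y, hy⟩ := exists_dist_eq (Γ := Γ) x ⌈5 * R / 4⌉₊
    have hle := Nat.le_ceil (5 * R / 4)
    have hlt := Nat.ceil_lt_add_one (by linarith : 0 ≤ 5 * R / 4)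
    rw [← hy] at hle hlt
    refine ⟨y, by rw [mem_ball]; linarith, fun z hz => ?_⟩
    rw [Set.mem_sdiff, mem_ball, mem_ball, not_lt]
    rw [mem_ball] at hz
    have h₁ : (Γ.graph.dist x z : ℝ) ≤ Γ.graph.dist x y + Γ.graph.dist y z :=
      mod_cast Γ.graph_connected.dist_triangle
    have h₂ : (Γ.graph.dist x y : ℝ) ≤ Γ.graph.dist x z + Γ.graph.dist y z := by
      rw [SimpleGraph.dist_comm (u := y)]
      exact_mod_cast Γ.graph_connected.dist_triangle
    constructor <;> linarith

theorem vol_le_mul_annulusVol [Infinite V] {D : ℝ} (hD : 0 ≤ D)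
    (hV : ∀ (x : V) (R : ℝ), 0 < R → Γ.vol x (2 * R) ≤ D * Γ.vol x R) (x : V) (hR : 1 / 2 < R) :
    Γ.vol x (2 * R) ≤ D ^ 4 * Γ.annulusVol x R (2 * R) := by
  obtain ⟨y, hy, hsub⟩ := exists_ball_subset_annulus (Γ := Γ) x hR
  rw [mem_ball, SimpleGraph.dist_comm] at hy
  calc Γ.vol x (2 * R) ≤ Γ.vol y (2 ^ 4 * (R / 4)) := vol_le_vol (by linarith)
    _ ≤ D ^ 4 * Γ.vol y (R / 4) := vol_two_pow_mul_le hD hV y (by linarith) 4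
    _ ≤ D ^ 4 * Γ.annulusVol x R (2 * R) :=
      mul_le_mul_of_nonneg_left (vol_le_annulusVol (by linarith) hsub) (pow_nonneg hD 4)

theorem meanExit_eq_potential_one [Countable V] [Infinite V] [MeasurableSpace V]
    [DiscreteMeasurableSpace V] (x : V) (R : ℝ) :
    Γ.meanExit x R = ENNReal.ofReal (Γ.potential (Γ.ballFinset x R) 1 x) := by
  rw [meanExit, ← coe_ballFinset, meanExitFrom_eq_potential_one]

end Balls

/-! ### The resistance of an annulus -/

theorem dist_le_of_mem_ball {x y z : V} {R : ℝ} (hy : R ≤ Γ.graph.dist x y + 1)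
    (hz : z ∈ Γ.ball x R) : Γ.graph.dist x z ≤ Γ.graph.dist x y :=
  Nat.lt_succ_iff.1 (by exact_mod_cast (mem_ball.1 hz).trans_le hy)

section Annulus

variable [Infinite V] [Γ.FiniteDegree] {K : ℝ} {x y z : V} {R : ℝ}

theorem exists_mem_ball_le_dist_add_one (x : V) (hR : 0 < R) :
    ∃ y ∈ Γ.ball x R, R ≤ Γ.graph.dist x y + 1 := by
  obtain ⟨y, hy⟩ := exists_dist_eq (Γ := Γ) x (⌈R⌉₊ - 1)
  have hceil : Γ.graph.dist x y + 1 = ⌈R⌉₊ := by have := Nat.ceil_pos.2 hR; omega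
  refine ⟨y, Nat.lt_ceil.1 (Nat.lt_of_succ_le hceil.le), (Nat.le_ceil R).trans_eq ?_⟩
  rw [← hceil, Nat.cast_add_one]

theorem HarnackConst.green_ballFinset_le_mul_of_dist_le (hK : Γ.HarnackConst K)
    (hy : y ∈ Γ.ball x R) (hyz : Γ.graph.dist x y ≤ Γ.graph.dist x z) :
    Γ.green (Γ.ballFinset x (2 * R)) x z ≤ K ^ 32 * Γ.green (Γ.ballFinset x (2 * R)) x y :=
  hK.green_le_mul_of_dist_le (fun w hw => mem_ballFinset.2 <| by
    have hw : (Γ.graph.dist x w : ℝ) ≤ 2 * Γ.graph.dist x y := mod_cast hw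
    linarith [mem_ball.1 hy]) hyz

theorem green_ballFinset_pos (hy : y ∈ Γ.ball x R) : 0 < Γ.green (Γ.ballFinset x R) x y :=
  green_pos fun _ hz => mem_ballFinset.2 ((Nat.cast_le.2 hz).trans_lt hy)

theorem HarnackConst.annulusRes_mem_Icc (hK : Γ.HarnackConst K) (hy : y ∈ Γ.ball x R)
    (hy' : R ≤ Γ.graph.dist x y + 1) :
    Γ.annulusRes x R (2 * R) ∈ Set.Icc ((K ^ 32)⁻¹ * Γ.green (Γ.ballFinset x (2 * R)) x y)
      (K ^ 32 * Γ.green (Γ.ballFinset x (2 * R)) x y) := by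
  have hK₀ : 0 < K ^ 32 := pow_pos hK.pos 32
  have hR : 0 < R := (Nat.cast_nonneg _).trans_lt hy
  have hpos : 0 < Γ.green (Γ.ballFinset x (2 * R)) x y :=
    green_ballFinset_pos (mem_ball.2 (by linarith [mem_ball.1 hy]))
  rw [annulusRes, ← coe_ballFinset x (2 * R)]
  refine resistance_mem_Icc (self_mem_ball x hR) (by positivity) (by positivity)
    (fun z hz => (inv_mul_le_iff₀ hK₀).2 ?_) ?_
  · exact hK.green_ballFinset_le_mul_of_dist_le hz (dist_le_of_mem_ball hy' hz)
  · have hnear : ∀ z, K ^ 32 * Γ.green (Γ.ballFinset x (2 * R)) x y <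
        Γ.green (Γ.ballFinset x (2 * R)) x z → Γ.graph.dist x z < Γ.graph.dist x y :=
      fun z hz => lt_of_not_ge fun h =>
        hz.not_ge (hK.green_ballFinset_le_mul_of_dist_le hy h)
    have hball : ∀ w, Γ.graph.dist x w ≤ Γ.graph.dist x y → w ∈ Γ.ball x R := fun w hw =>
      mem_ball.2 ((Nat.cast_le.2 hw).trans_lt (mem_ball.1 hy))
    rintro w (hw | ⟨z, hz, hzw⟩)
    · exact hball w (hnear w hw).le
    · exact hball w ((dist_le_succ_of_weight_pos x hzw).trans (hnear z hz))

theorem HarnackConst.annulusRes_nonneg (hK : Γ.HarnackConst K) (x : V) (hR : 0 < R) :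
    0 ≤ Γ.annulusRes x R (2 * R) := by
  obtain ⟨y, hy, hy'⟩ := exists_mem_ball_le_dist_add_one (Γ := Γ) x hR
  exact (mul_nonneg (inv_nonneg.2 (pow_nonneg hK.pos.le 32)) (green_nonneg y)).trans
    (hK.annulusRes_mem_Icc hy hy').1

theorem HarnackConst.annulusRes_le_mul_green (hK : Γ.HarnackConst K) (hz : z ∈ Γ.ball x R) :
    Γ.annulusRes x R (2 * R) ≤ K ^ 64 * Γ.green (Γ.ballFinset x (2 * R)) x z := by
  obtain ⟨y, hy, hy'⟩ :=
    exists_mem_ball_le_dist_add_one (Γ := Γ) x ((Nat.cast_nonneg _).trans_lt hz)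
  calc Γ.annulusRes x R (2 * R) ≤ K ^ 32 * Γ.green (Γ.ballFinset x (2 * R)) x y :=
        (hK.annulusRes_mem_Icc hy hy').2
    _ ≤ K ^ 32 * (K ^ 32 * Γ.green (Γ.ballFinset x (2 * R)) x z) :=
      mul_le_mul_of_nonneg_left
        (hK.green_ballFinset_le_mul_of_dist_le hz (dist_le_of_mem_ball hy' hz))
        (pow_nonneg hK.pos.le 32)
    _ = K ^ 64 * Γ.green (Γ.ballFinset x (2 * R)) x z := by ring

theorem HarnackConst.green_le_mul_annulusRes (hK : Γ.HarnackConst K) (hR : 0 < R)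
    (hz : R ≤ Γ.graph.dist x z + 1) :
    Γ.green (Γ.ballFinset x (2 * R)) x z ≤ K ^ 64 * Γ.annulusRes x R (2 * R) := by
  obtain ⟨y, hy, hy'⟩ := exists_mem_ball_le_dist_add_one (Γ := Γ) x hR
  have hK₀ : 0 < K ^ 32 := pow_pos hK.pos 32
  calc Γ.green (Γ.ballFinset x (2 * R)) x z
      ≤ K ^ 32 * Γ.green (Γ.ballFinset x (2 * R)) x y :=
        hK.green_ballFinset_le_mul_of_dist_le hy (dist_le_of_mem_ball hz hy)
    _ ≤ K ^ 32 * (K ^ 32 * Γ.annulusRes x R (2 * R)) := mul_le_mul_of_nonneg_left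
        ((inv_mul_le_iff₀ hK₀).1 (hK.annulusRes_mem_Icc hy hy').1) hK₀.le
    _ = K ^ 64 * Γ.annulusRes x R (2 * R) := by ring

end Annulus

/-! ### The Einstein relation -/

section Einstein

variable [Infinite V] [Γ.FiniteDegree] {K C : ℝ} {x : V} {R : ℝ}

theorem HarnackConst.annulusRes_mul_vol_le (hK : Γ.HarnackConst K) (x : V) (hR : 0 < R) :
    Γ.annulusRes x R (2 * R) * Γ.vol x R ≤
      K ^ 64 * Γ.potential (Γ.ballFinset x (2 * R)) 1 x := by
  rw [vol_eq_sum, ← sum_green_mul_eq_potential, Finset.mul_sum, Finset.mul_sum]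
  calc ∑ z ∈ Γ.ballFinset x R, Γ.annulusRes x R (2 * R) * Γ.mass z
      ≤ ∑ z ∈ Γ.ballFinset x R,
          K ^ 64 * (Γ.green (Γ.ballFinset x (2 * R)) x z * 1 * Γ.mass z) := by
        refine Finset.sum_le_sum fun z hz => ?_
        rw [mul_one, ← mul_assoc]
        exact mul_le_mul_of_nonneg_right (hK.annulusRes_le_mul_green (mem_ballFinset.1 hz))
          (mass_nonneg z)
    _ ≤ ∑ z ∈ Γ.ballFinset x (2 * R),
          K ^ 64 * (Γ.green (Γ.ballFinset x (2 * R)) x z * 1 * Γ.mass z) :=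
        Finset.sum_le_sum_of_subset_of_nonneg (ballFinset_mono x (by linarith)) fun z _ _ =>
          mul_nonneg (pow_nonneg hK.pos.le 64)
            (mul_nonneg (mul_nonneg (green_nonneg z) zero_le_one) (mass_nonneg z))

theorem potential_one_le_add_mul_sum_mass {U W : Finset V} (hWU : W ⊆ U) {M : ℝ}
    (hM : ∀ z ∉ W, Γ.green U x z ≤ M) :
    Γ.potential U 1 x ≤ Γ.potential W 1 x + M * ∑ z ∈ U, Γ.mass z := by
  have hgreen : ∀ z, Γ.green U x z ≤ Γ.green W x z + M := potential_le_potential_add hWU hM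
  have hW : ∑ z ∈ U, Γ.green W x z * 1 * Γ.mass z = Γ.potential W 1 x := by
    rw [← sum_green_mul_eq_potential]
    exact (Finset.sum_subset hWU fun z _ hz => by rw [green_eq_zero hz]; simp).symm
  rw [← hW, ← sum_green_mul_eq_potential, Finset.mul_sum, ← Finset.sum_add_distrib]
  refine Finset.sum_le_sum fun z _ => ?_
  simpa only [mul_one, Pi.one_apply, add_mul] using
    mul_le_mul_of_nonneg_right (hgreen z) (mass_nonneg z)

-- The walk from `x` leaves `B(x,R-1)` at a vertex `y ∈ B(x,R)`, and `B(y,R) ⊆ B(x,2R)`.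
theorem potential_one_add_inv_mul_le (hC : 0 < C)
    (hT : ∀ y ∈ Γ.ball x R,
      Γ.potential (Γ.ballFinset x R) 1 x ≤ C * Γ.potential (Γ.ballFinset y R) 1 y) (hR : 0 < R) :
    Γ.potential (Γ.ballFinset x (R - 1)) 1 x ≤
      C * (Γ.potential (Γ.ballFinset x (2 * R)) 1 x -
        Γ.potential (Γ.ballFinset x (R - 1)) 1 x) := by
  have hone : ∀ {U : Finset V}, ∀ z ∈ U, (0 : ℝ) ≤ (1 : V → ℝ) z := fun _ _ => zero_le_one
  have hsub : Γ.ballFinset x (R - 1) ⊆ Γ.ballFinset x (2 * R) := ballFinset_mono x (by linarith)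
  rw [← inv_mul_le_iff₀ hC, le_sub_iff_add_le']
  by_cases hx : x ∈ Γ.ballFinset x (R - 1)
  · refine potential_add_le_potential hsub (fun y hy => (inv_mul_le_iff₀ hC).2 ?_) hx
    have hyR : y ∈ Γ.ball x R := by
      obtain hy' | ⟨z, hz, hzy⟩ := hy.1
      · exact absurd hy' hy.2
      · have hz : (Γ.graph.dist x z : ℝ) < R - 1 := mem_ballFinset.1 hz
        have : (Γ.graph.dist x y : ℝ) ≤ Γ.graph.dist x z + 1 :=
          mod_cast dist_le_succ_of_weight_pos x hzy
        rw [mem_ball]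
        linarith
    calc Γ.potential (Γ.ballFinset x (R - 1)) 1 x
        ≤ Γ.potential (Γ.ballFinset x R) 1 x :=
          potential_mono (ballFinset_mono x (by linarith)) hone x
      _ ≤ C * Γ.potential (Γ.ballFinset y R) 1 y := hT y hyR
      _ ≤ C * Γ.potential (Γ.ballFinset x (2 * R)) 1 y :=
          mul_le_mul_of_nonneg_left (potential_mono
            (ballFinset_subset (by linarith [mem_ball.1 hyR])) hone y) hC.le
  · rw [potential_eq_zero hx, mul_zero, add_zero]
    exact potential_one_nonneg x

theorem HarnackConst.potential_one_le (hK : Γ.HarnackConst K) (hC : 0 < C)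
    (hT : ∀ y ∈ Γ.ball x R,
      Γ.potential (Γ.ballFinset x R) 1 x ≤ C * Γ.potential (Γ.ballFinset y R) 1 y) (hR : 0 < R) :
    Γ.potential (Γ.ballFinset x (2 * R)) 1 x ≤
      (C + 1) * (K ^ 64 * (Γ.annulusRes x R (2 * R) * Γ.vol x (2 * R))) := by
  have hincr : Γ.potential (Γ.ballFinset x (2 * R)) 1 x -
      Γ.potential (Γ.ballFinset x (R - 1)) 1 x ≤
        K ^ 64 * (Γ.annulusRes x R (2 * R) * Γ.vol x (2 * R)) := by
    rw [sub_le_iff_le_add', ← mul_assoc, vol_eq_sum]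
    refine potential_one_le_add_mul_sum_mass (ballFinset_mono x (by linarith)) fun z hz =>
      hK.green_le_mul_annulusRes hR ?_
    rw [mem_ballFinset, not_lt] at hz
    linarith
  have hinner := (potential_one_add_inv_mul_le hC hT hR).trans
    (mul_le_mul_of_nonneg_left hincr hC.le)
  linarith

theorem HarnackConst.annulusRes_mul_annulusVol_le (hK : Γ.HarnackConst K) {D : ℝ}
    (hD : 0 ≤ D) (hV : ∀ (x : V) (R : ℝ), 0 < R → Γ.vol x (2 * R) ≤ D * Γ.vol x R) (x : V)
    (hR : 0 < R) :
    Γ.annulusRes x R (2 * R) * Γ.annulusVol x R (2 * R) ≤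
      D * K ^ 64 * Γ.potential (Γ.ballFinset x (2 * R)) 1 x := by
  calc Γ.annulusRes x R (2 * R) * Γ.annulusVol x R (2 * R)
      ≤ Γ.annulusRes x R (2 * R) * (D * Γ.vol x R) := mul_le_mul_of_nonneg_left
        ((annulusVol_le_vol x R (2 * R)).trans (hV x R hR)) (hK.annulusRes_nonneg x hR)
    _ = D * (Γ.annulusRes x R (2 * R) * Γ.vol x R) := mul_left_comm _ _ _
    _ ≤ D * (K ^ 64 * Γ.potential (Γ.ballFinset x (2 * R)) 1 x) :=
      mul_le_mul_of_nonneg_left (hK.annulusRes_mul_vol_le x hR) hD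
    _ = D * K ^ 64 * Γ.potential (Γ.ballFinset x (2 * R)) 1 x := (mul_assoc _ _ _).symm

theorem HarnackConst.potential_one_le_mul_annulusRes_mul_annulusVol (hK : Γ.HarnackConst K)
    {D : ℝ} (hD : 0 ≤ D)
    (hV : ∀ (x : V) (R : ℝ), 0 < R → Γ.vol x (2 * R) ≤ D * Γ.vol x R) (hC : 0 < C)
    (hT : ∀ y ∈ Γ.ball x R,
      Γ.potential (Γ.ballFinset x R) 1 x ≤ C * Γ.potential (Γ.ballFinset y R) 1 y)
    (hR : 1 / 2 < R) :
    Γ.potential (Γ.ballFinset x (2 * R)) 1 x ≤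
      (C + 1) * K ^ 64 * D ^ 4 * (Γ.annulusRes x R (2 * R) * Γ.annulusVol x R (2 * R)) := by
  have hR₀ : 0 < R := one_half_pos.trans hR
  have hK₀ := hK.pos
  have hρ := hK.annulusRes_nonneg x hR₀
  calc Γ.potential (Γ.ballFinset x (2 * R)) 1 x
      ≤ (C + 1) * (K ^ 64 * (Γ.annulusRes x R (2 * R) * Γ.vol x (2 * R))) :=
        hK.potential_one_le hC hT hR₀
    _ ≤ (C + 1) * (K ^ 64 * (Γ.annulusRes x R (2 * R) *
          (D ^ 4 * Γ.annulusVol x R (2 * R)))) := by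
        gcongr
        exact vol_le_mul_annulusVol hD hV x hR
    _ = (C + 1) * K ^ 64 * D ^ 4 * (Γ.annulusRes x R (2 * R) * Γ.annulusVol x R (2 * R)) := by
        ring

end Einstein

theorem WeakTimeComparison.exists_potential_le [Countable V] [Infinite V] [MeasurableSpace V]
    [DiscreteMeasurableSpace V] [Γ.FiniteDegree] (hT : Γ.WeakTimeComparison) :
    ∃ C : ℝ, 0 < C ∧ ∀ (x : V) (R : ℝ), 0 < R → ∀ y ∈ Γ.ball x R,
      Γ.potential (Γ.ballFinset x R) 1 x ≤ C * Γ.potential (Γ.ballFinset y R) 1 y := by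
  obtain ⟨C, hC, hT⟩ := hT
  refine ⟨C, hC, fun x R hR y hy => ?_⟩
  have h := hT x R hR y hy
  rwa [meanExit_eq_potential_one, meanExit_eq_potential_one, ← ENNReal.ofReal_mul hC.le,
    ENNReal.ofReal_le_ofReal_iff (mul_nonneg hC.le (potential_one_nonneg y))] at h

end WeightedGraph

theorem mainTheorem2 {V : Type*} [Countable V] [Infinite V]
    [MeasurableSpace V] [DiscreteMeasurableSpace V] (Γ : WeightedGraph V)
    (hp : Γ.ControlledWeights) (hV : Γ.VolumeDoubling) (hH : Γ.EllipticHarnack)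
    (hT : Γ.WeakTimeComparison) :
    ∃ C : ℝ, 1 < C ∧ ∀ (x : V) (R : ℝ), 1 / 2 < R →
      ENNReal.ofReal (C⁻¹ * (Γ.annulusRes x R (2 * R) * Γ.annulusVol x R (2 * R))) ≤
          Γ.meanExit x (2 * R) ∧
        Γ.meanExit x (2 * R) ≤
          ENNReal.ofReal (C * (Γ.annulusRes x R (2 * R) * Γ.annulusVol x R (2 * R))) := by
  have := hp.finiteDegree
  obtain ⟨K, hK⟩ := hp.exists_harnackConst hH
  obtain ⟨D, hD, hV⟩ := hV
  obtain ⟨C, hC, hT⟩ := hT.exists_potential_le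
  have hlower_pos : 0 < D * K ^ 64 := mul_pos hD (pow_pos hK.pos 64)
  have hupper_pos : 0 < (C + 1) * K ^ 64 * D ^ 4 :=
    mul_pos (mul_pos (by linarith) (pow_pos hK.pos 64)) (pow_pos hD 4)
  refine ⟨1 + D * K ^ 64 + (C + 1) * K ^ 64 * D ^ 4, by linarith, fun x R hR => ?_⟩
  have hR₀ : 0 < R := one_half_pos.trans hR
  have hlower := hK.annulusRes_mul_annulusVol_le hD.le hV x hR₀
  have hupper := hK.potential_one_le_mul_annulusRes_mul_annulusVol hD.le hV hC (hT x R hR₀) hR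
  have he := WeightedGraph.potential_one_nonneg (Γ := Γ) (U := Γ.ballFinset x (2 * R)) x
  have hρv : 0 ≤ Γ.annulusRes x R (2 * R) * Γ.annulusVol x R (2 * R) :=
    nonneg_of_mul_nonneg_right (he.trans hupper) hupper_pos
  rw [WeightedGraph.meanExit_eq_potential_one]
  constructor <;> refine ENNReal.ofReal_le_ofReal ?_
  · rw [inv_mul_le_iff₀ (by linarith)]
    exact hlower.trans (mul_le_mul_of_nonneg_right (by linarith) he)
  · exact hupper.trans (mul_le_mul_of_nonneg_right (by linarith) hρv)
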